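/- **Corollary (non-uniform variance vector).** Let $n\ge 1$, $k\ge 0$, and consider one-dimensional periodic convolutional networks with spatial locations $\mathbb Z/n$, kernel positions $\mathrm{ker}=\{\beta\in\mathbb Z:|\beta|\le k\}$, $c$ channels and activation function $\phi:\mathbb R\to\mathbb R$: given an input $x^0=(x^0_i(\alpha))$ with $c$ channels, $$h^{l+1}_j(\alpha)=\sum_{i=1}^c\sum_{\beta\in \mathrm{ker}}x^l_i(\alpha+\beta)\,\omega^{l+1}_{ij}(\beta)+b^{l+1}_j\quad(l\ge 0),\qquad x^l_i(\alpha)=\phi(h^l_i(\alpha))\quad(l\ge1).$$ Let $v=(v_\beta)_{\beta\in\mathrm{ker}}$ be non-negative with $\sum_\beta v_\beta=1$ and let $\sigma_w,\sigma_b\in\mathbb R$. For every width $c$, let all weights and biases of all layers be independent with $\omega^l_{ij}(\beta)\sim\mathcal N(0,v_\beta\sigma_w^2/c)$ and $b^l_j\sim\mathcal N(0,\sigma_b^2)$. For $n\times n$ matrices define $$(\mathcal A_v\star f)_{\alpha,\alpha'}=\sum_{\beta\in\mathrm{ker}}v_\beta f_{\alpha+\beta,\alpha'+\beta},\qquad [\mathcal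 C(\Sigma)]_{\alpha,\alpha'}=\sigma_w^2\,\mathbb E_{h\sim\mathcal N(0,\Sigma)}[\phi(h_\alpha)\phi(h_{\alpha'})]+\sigma_b^2 .$$ Assume that $\phi$ is measurable and square integrable under every centered Gaussian on $\mathbb R$ (so that $\mathcal C$ is defined on all positive semidefinite matrices), and that the (deterministic) inputs, one for every $c$, satisfy $\frac1c\sum_{i=1}^c x^0_i(\alpha)x^0_i(\alpha')\to G_{\alpha,\alpha'}$ as $c\to\infty$ for all $\alpha,\alpha'$. Put $\Sigma^1=\mathcal A_v\star(\sigma_w^2G+\sigma_b^2)$, where $\sigma_b^2$ is added to every entry, and assume that $\phi$ is continuous at $0$ or that all diagonal entries of $\Sigma^1$ are positive. Then there are positive semidefinite matrices $\Sigma^l$, $l\ge 1$, starting with this $\Sigma^1$, such that 1. for every $l\ge1$ and $m\ge 0$, as $c\to\infty$ the first $m$ channels $(h^l_1,\dots,h^l_m)$ converge jointly in distribution to $m$ independent $\mathcal N(0,\Sigma^l)$ vectors; 2. if moreover $|\phi(x)|\le C(1+|x|)^p$ for some $C,p$ and all $x$, then at every finite width all $h^l_j(\alpha)$, $l\ge1$,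 are square integrable with mean zero, and for every $l\ge1$, $\mathbb E[h^l_j(\alpha)h^l_j(\alpha')]\to\Sigma^l_{\alpha,\alpha'}$ as $c\to\infty$, uniformly in the channel $j$ and in $\alpha,\alpha'$; 3. the covariance matrices satisfy the recurrence $$\Sigma^{l+1}=\mathcal A_v\star\mathcal C(\Sigma^l)\qquad\text{for all } l\ge1,$$ and also for $l=0$ whenever $\Sigma^0$ is a positive semidefinite matrix with $G_{\alpha,\alpha'}=\mathbb E_{h\sim\mathcal N(0,\Sigma^0)}[\phi(h_\alpha)\phi(h_{\alpha'})]$. -/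

import Mathlib

open MeasureTheory ProbabilityTheory Filter Topology
open scoped NNReal

/-- Kernel positions `β ∈ ℤ`, `|β| ≤ k`. -/
abbrev Ker (k : ℕ) : Type := ↥(Finset.Icc (-(k : ℤ)) (k : ℤ))

/-- One periodic convolutional layer with `c` channels and spatial locations `ZMod n`:
`h_j(α) = ∑_i ∑_β x_i(α + β) w_{ij}(β) + b_j`. -/
noncomputable def convLayer {n k c : ℕ} (x : Fin c → ZMod n → ℝ) (w : Fin c → Fin c → Ker k → ℝ)
    (b : Fin c → ℝ) : Fin c → ZMod n → ℝ :=
  fun j α => (∑ i, ∑ β : Ker k, x i (α + ((β : ℤ) : ZMod n)) * w i j β) + b j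

/-- Post-activations `x^l`: `x^0` is the input and `x^(l+1) = φ(h^(l+1))`, where `h^(l+1)` is
computed from `x^l` with the weights and biases of layer `l + 1`. -/
noncomputable def postAct {n k c : ℕ} (φ : ℝ → ℝ) (x0 : Fin c → ZMod n → ℝ)
    (w : ℕ → Fin c → Fin c → Ker k → ℝ) (b : ℕ → Fin c → ℝ) : ℕ → Fin c → ZMod n → ℝ
  | 0 => x0
  | l + 1 => fun j α => φ (convLayer (postAct φ x0 w b l) (w (l + 1)) (b (l + 1)) j α)

/-- `nextPreAct φ x0 w b l` is the family of pre-activations `h^(l+1)` of layer `l + 1`. -/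
noncomputable def nextPreAct {n k c : ℕ} (φ : ℝ → ℝ) (x0 : Fin c → ZMod n → ℝ)
    (w : ℕ → Fin c → Fin c → Ker k → ℝ) (b : ℕ → Fin c → ℝ) (l : ℕ) : Fin c → ZMod n → ℝ :=
  convLayer (postAct φ x0 w b l) (w (l + 1)) (b (l + 1))

/-- Random initialization with variance vector `v`: all weights and biases of all layers are
jointly independent, `w^l_{ij}(β) ∼ N(0, v_β σw² / c)` and `b^l_j ∼ N(0, σb²)`. -/
structure IsGaussianInit {Ω : Type*} [MeasurableSpace Ω] (μ : Measure Ω) {k c : ℕ}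
    (v : Ker k → ℝ) (σw σb : ℝ) (w : ℕ → Fin c → Fin c → Ker k → Ω → ℝ)
    (b : ℕ → Fin c → Ω → ℝ) : Prop where
  weight_law : ∀ l i j β, HasLaw (w l i j β) (gaussianReal 0 (v β * σw ^ 2 / c).toNNReal) μ
  bias_law : ∀ l j, HasLaw (b l j) (gaussianReal 0 (σb ^ 2).toNNReal) μ
  indep : iIndepFun
    (Sum.elim (fun p : ℕ × Fin c × Fin c × Ker k => w p.1 p.2.1 p.2.2.1 p.2.2.2)
      (fun q : ℕ × Fin c => b q.1 q.2)) μ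

/-- `𝒜_v ⋆ f`: cross-correlation with weights `v_β` along the cyclic diagonals. -/
noncomputable def crossCorr {n k : ℕ} (v : Ker k → ℝ) (f : Matrix (ZMod n) (ZMod n) ℝ) :
    Matrix (ZMod n) (ZMod n) ℝ :=
  Matrix.of fun α α' =>
    ∑ β : Ker k, v β * f (α + ((β : ℤ) : ZMod n)) (α' + ((β : ℤ) : ZMod n))

/-- `σw² M + σb²` (entrywise). -/
noncomputable def affineCov {n : ℕ} (σw σb : ℝ) (M : Matrix (ZMod n) (ZMod n) ℝ) :
    Matrix (ZMod n) (ZMod n) ℝ :=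
  Matrix.of fun α α' => σw ^ 2 * M α α' + σb ^ 2

/-- The matrix `E_{h ∼ N(0, S)}[φ(h_α) φ(h_α')]`. -/
noncomputable def gaussMoment {n : ℕ} [NeZero n] (φ : ℝ → ℝ) (S : Matrix (ZMod n) (ZMod n) ℝ) :
    Matrix (ZMod n) (ZMod n) ℝ :=
  Matrix.of fun α α' => ∫ h, φ (h α) * φ (h α') ∂(multivariateGaussian 0 S)

/-- The `𝒞`-map: `𝒞(S)_{α α'} = σw² E_{h ∼ N(0, S)}[φ(h_α) φ(h_α')] + σb²`. -/
noncomputable def cMap {n : ℕ} [NeZero n] (φ : ℝ → ℝ) (σw σb : ℝ)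
    (S : Matrix (ZMod n) (ZMod n) ℝ) : Matrix (ZMod n) (ZMod n) ℝ :=
  affineCov σw σb (gaussMoment φ S)

/-!
Conditionally on the activations `x` of a layer, the pre-activations of the next layer are linear in
independent Gaussian parameters: their channels are i.i.d. `N(0, K)` vectors, where the covariance
`K = layerCov v σw σb x` is a continuous function of the empirical second moments
`c⁻¹ ∑ᵢ xᵢ xᵢᵀ` (`map_convLayer_eq_pi`, `IsGaussianInit.lintegral_preActVec`). All assertions follow
once the random matrix `K` is shown to converge in probability to a deterministic limit in every
layer (`tendstoInProb_layerCov`), by induction on the layer.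

The inductive step is a law of large numbers for the averages of `φ(h_α) φ(h_α')` over the channels,
uniform over the covariances near the limit `S` (`eventually_measure_pi_avg_le`). As `φ` is merely
measurable and `φ ⊗ φ` merely integrable, `φ` is replaced by bounded continuous functions that
approximate it in `L²(N(0, s))` uniformly for `s` near a diagonal entry of `S`
(`exists_boundedContinuous_eLpNorm_sub_le_gaussianReal`); for these, Chebyshev's inequality and the
weak continuity of `K ↦ N(0, K)` suffice.

The delicate case is a vanishing diagonal entry of `S` with `φ` discontinuous at `0`. The induction
therefore carries along that the corresponding entry of `K` is exactly zero with probability tending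
to one (`admissibleCov`). This is preserved: a zero on the diagonal of `𝒜_v ⋆ 𝒞(S)` forces
`σb = 0` and `φ(h) = 0` almost surely in the limit for every `h` contributing to it, hence also at
finite width with probability tending to one (`tendsto_measure_exists_ne_zero`).

Convergence in distribution follows by integrating the continuous function `K ↦ ∫ f dN(0, K)^m`
against the law of `K`. For polynomially bounded `φ` the moments of `K` are bounded in the width, so
that `𝔼[h_α h_α'] = 𝔼[K_α α']` converges as well (`tendsto_integral_layerCov`).
-/

open scoped ENNReal

/-! ### Approximation under one-dimensional Gaussians -/

lemma gaussianReal_le_smul {s t : ℝ≥0} (hs : s ≠ 0) (ht : t ≠ 0) {A : Set ℝ} (hA : MeasurableSet A)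
    {r : ℝ≥0} (h : ∀ x ∈ A, gaussianPDFReal 0 s x ≤ r * gaussianPDFReal 0 t x) :
    (gaussianReal 0 s).restrict A ≤ (r : ℝ≥0∞) • gaussianReal 0 t := by
  refine Measure.le_intro fun B hB _ => ?_
  rw [Measure.restrict_apply hB, Measure.smul_apply, gaussianReal_apply _ hs,
    gaussianReal_apply _ ht, smul_eq_mul, ← lintegral_const_mul _ (measurable_gaussianPDF _ _)]
  refine (lintegral_mono_ae ?_).trans (lintegral_mono_set Set.inter_subset_left)
  filter_upwards [ae_restrict_mem (hB.inter hA)] with x hx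
  rw [gaussianPDF_def, gaussianPDF_def, ← ENNReal.ofReal_coe_nnreal,
    ← ENNReal.ofReal_mul r.coe_nonneg]
  exact ENNReal.ofReal_le_ofReal (h x hx.2)

/-- Near a positive variance all centered Gaussians are dominated by a single one. -/
lemma gaussianReal_le_of_le_of_le {a s b : ℝ≥0} (ha : 0 < a) (has : a ≤ s) (hsb : s ≤ b) :
    gaussianReal 0 s ≤ (NNReal.sqrt (b / a) : ℝ≥0∞) • gaussianReal 0 b := by
  have hs : 0 < s := ha.trans_le has
  have hb : 0 < b := hs.trans_le hsb
  have := gaussianReal_le_smul hs.ne' hb.ne' MeasurableSet.univ (r := NNReal.sqrt (b / a)) ?_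
  · rwa [Measure.restrict_univ] at this
  intro x _
  have ha' : (0 : ℝ) < a := ha
  have hs' : (0 : ℝ) < s := hs
  have hb' : (0 : ℝ) < b := hb
  have has' : (a : ℝ) ≤ s := has
  have hsb' : (s : ℝ) ≤ b := hsb
  rw [gaussianPDFReal_def, gaussianPDFReal_def]
  simp only [sub_zero, Real.coe_sqrt, NNReal.coe_div]
  rw [← mul_assoc]
  have h1 : Real.exp (-x ^ 2 / (2 * s)) ≤ Real.exp (-x ^ 2 / (2 * b)) := by
    apply Real.exp_le_exp.2
    rw [neg_div, neg_div, neg_le_neg_iff]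
    gcongr
  have h2 : (√(2 * Real.pi * s))⁻¹ ≤ √(b / a : ℝ) * (√(2 * Real.pi * b))⁻¹ := by
    rw [← Real.sqrt_inv, ← Real.sqrt_inv, ← Real.sqrt_mul (by positivity)]
    apply Real.sqrt_le_sqrt
    have : (b / a : ℝ) * (2 * Real.pi * b)⁻¹ = (2 * Real.pi * a)⁻¹ := by
      field_simp
    rw [this]
    gcongr
  gcongr

/-- Away from the origin, the centered Gaussians of small variance `s` are dominated by the standard
one, with a constant that vanishes as `s → 0`. -/
lemma gaussianReal_restrict_compl_ball_le {s δ : ℝ≥0} (hs : 0 < s) (hs2 : s ≤ 1 / 2) (hδ : 0 < δ) :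
    (gaussianReal 0 s).restrict (Metric.ball (0 : ℝ) δ)ᶜ ≤
      ((4 * NNReal.sqrt s / δ ^ 2 : ℝ≥0) : ℝ≥0∞) • gaussianReal 0 1 := by
  refine gaussianReal_le_smul hs.ne' one_ne_zero Metric.isOpen_ball.measurableSet.compl ?_
  intro x hx
  have hx' : (δ : ℝ) ≤ |x| := by simpa using hx
  have hs' : (0 : ℝ) < s := hs
  have hs2' : (s : ℝ) ≤ 1 / 2 := by exact_mod_cast hs2
  have hδ' : (0 : ℝ) < δ := hδ
  have hxd : (δ : ℝ) ^ 2 ≤ x ^ 2 := by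
    rw [← sq_abs x]; gcongr
  rw [gaussianPDFReal_def, gaussianPDFReal_def]
  simp only [sub_zero, NNReal.coe_div, NNReal.coe_mul, Real.coe_sqrt, NNReal.coe_one,
    NNReal.coe_pow, NNReal.coe_ofNat, mul_one]
  -- the quadratic exponent gains at least `δ² / (4 s)`
  have h1 : Real.exp (-x ^ 2 / (2 * s)) ≤ (4 * s / δ ^ 2) * Real.exp (-x ^ 2 / 2) := by
    have e1 : Real.exp (-x ^ 2 / (2 * s)) ≤
        Real.exp (-(δ ^ 2 / (4 * s))) * Real.exp (-x ^ 2 / 2) := by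
      rw [← Real.exp_add]
      apply Real.exp_le_exp.2
      have : x ^ 2 / (2 * s) - x ^ 2 / 2 - δ ^ 2 / (4 * s)
          = (2 * x ^ 2 - 2 * s * x ^ 2 - δ ^ 2) / (4 * s) := by field_simp; ring
      have h0 : 0 ≤ (2 * x ^ 2 - 2 * s * x ^ 2 - δ ^ 2) / (4 * s) := by
        apply div_nonneg _ (by positivity)
        nlinarith [sq_nonneg x]
      rw [neg_div, neg_div]
      linarith
    refine e1.trans ?_
    gcongr
    rw [Real.exp_neg, inv_le_comm₀ (Real.exp_pos _) (by positivity), inv_div]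
    have := Real.add_one_le_exp ((δ : ℝ) ^ 2 / (4 * s))
    linarith
  have h2 : (√(2 * Real.pi * s))⁻¹ = (√s)⁻¹ * (√(2 * Real.pi))⁻¹ := by
    rw [mul_comm, Real.sqrt_mul hs'.le, mul_inv]
  have h3 : (√(s : ℝ))⁻¹ * s = √s := by
    rw [inv_mul_eq_div, Real.div_sqrt]
  calc (√(2 * Real.pi * s))⁻¹ * Real.exp (-x ^ 2 / (2 * s))
      ≤ (√(2 * Real.pi * s))⁻¹ * ((4 * s / δ ^ 2) * Real.exp (-x ^ 2 / 2)) := by gcongr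
    _ = 4 * ((√(s : ℝ))⁻¹ * s) / δ ^ 2 * ((√(2 * Real.pi))⁻¹ * Real.exp (-x ^ 2 / 2)) := by
        rw [h2]; ring
    _ = _ := by rw [h3]

lemma tendsto_eLpNorm_sub_const_gaussianReal {φ : ℝ → ℝ} (hφm : Measurable φ)
    (hφ : ∀ s : ℝ≥0, MemLp φ 2 (gaussianReal 0 s)) (hc : ContinuousAt φ 0) :
    Tendsto (fun s : ℝ≥0 => eLpNorm (fun x => φ x - φ 0) 2 (gaussianReal 0 s)) (𝓝 0) (𝓝 0) := by
  set g : ℝ → ℝ := fun x => φ x - φ 0 with hg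
  have hgm : Measurable g := hφm.sub_const _
  have hL : MemLp g 2 (gaussianReal 0 1) := (hφ 1).sub (memLp_const _)
  rw [ENNReal.tendsto_nhds_zero]
  intro ε hε
  have hε2 : ε / 2 ≠ 0 := (ENNReal.half_pos hε.ne').ne'
  obtain ⟨δ, hδ, hball⟩ : ∃ δ : ℝ≥0, 0 < δ ∧ ∀ x ∈ Metric.ball (0 : ℝ) δ, ‖g x‖ₑ ≤ ε / 2 := by
    have : Tendsto (fun x => ‖g x‖ₑ) (𝓝 0) (𝓝 0) := by
      have h1 : ContinuousAt g 0 := hc.sub continuousAt_const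
      have h2 := h1.enorm
      simpa [ContinuousAt, hg] using h2
    obtain ⟨δ, hδ, h⟩ := Metric.eventually_nhds_iff_ball.1 (ENNReal.tendsto_nhds_zero.1 this _
      (pos_iff_ne_zero.2 hε2))
    exact ⟨⟨δ, hδ.le⟩, hδ, h⟩
  have hlim : Tendsto (fun s : ℝ≥0 => ((4 * NNReal.sqrt s / δ ^ 2 : ℝ≥0) : ℝ≥0∞) ^ (1 / 2 : ℝ) *
      eLpNorm g 2 (gaussianReal 0 1)) (𝓝 0) (𝓝 0) := by
    have h1 : Tendsto (fun s : ℝ≥0 => ((4 * NNReal.sqrt s / δ ^ 2 : ℝ≥0) : ℝ≥0∞)) (𝓝 0) (𝓝 0) := by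
      rw [← ENNReal.coe_zero, ENNReal.tendsto_coe]
      have : Continuous fun s : ℝ≥0 => 4 * NNReal.sqrt s / δ ^ 2 := by fun_prop
      simpa using this.tendsto 0
    have h2 := (ENNReal.continuous_rpow_const (y := (1 / 2 : ℝ))).tendsto 0 |>.comp h1
    have h3 := ENNReal.Tendsto.mul_const h2 (Or.inr hL.eLpNorm_ne_top)
    simpa using h3
  filter_upwards [ENNReal.tendsto_nhds_zero.1 hlim _ (pos_iff_ne_zero.2 hε2),
    Iic_mem_nhds (show (0 : ℝ≥0) < 1 / 2 by norm_num)] with s hs1 hs2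
  rcases eq_or_ne s 0 with rfl | hs0
  · simp [gaussianReal_zero_var, hg, eLpNorm_dirac]
  set B := Metric.ball (0 : ℝ) δ
  have hB : MeasurableSet B := Metric.isOpen_ball.measurableSet
  have hsum : g = B.indicator g + Bᶜ.indicator g := (Set.indicator_self_add_compl B g).symm
  have hle : eLpNorm g 2 (gaussianReal 0 s) ≤ eLpNorm (B.indicator g) 2 (gaussianReal 0 s) +
      eLpNorm (Bᶜ.indicator g) 2 (gaussianReal 0 s) := by
    conv_lhs => rw [hsum]
    exact eLpNorm_add_le (hgm.indicator hB).aestronglyMeasurable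
      (hgm.indicator hB.compl).aestronglyMeasurable (by norm_num)
  refine hle.trans ((add_le_add ?_ ?_).trans (ENNReal.add_halves ε).le)
  · rw [eLpNorm_indicator_eq_eLpNorm_restrict hB]
    refine (eLpNorm_le_of_ae_enorm_bound (C := ε / 2) ?_).trans ?_
    · filter_upwards [ae_restrict_mem hB] with x hx using hball x hx
    · rw [smul_eq_mul]
      refine mul_le_of_le_one_right' ?_
      rw [Measure.restrict_apply_univ]
      refine (ENNReal.rpow_le_rpow prob_le_one (by positivity)).trans ?_
      simp
  · rw [eLpNorm_indicator_eq_eLpNorm_restrict hB.compl]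
    refine (eLpNorm_mono_measure _ (gaussianReal_restrict_compl_ball_le
      (pos_iff_ne_zero.2 hs0) hs2 hδ)).trans ?_
    rw [eLpNorm_smul_measure_of_ne_top (by norm_num)]
    simpa using hs1

/-- A bounded continuous function approximates `φ` in `L²(N(0, s))` uniformly for `s` near `s₀`.
If `s₀ = 0` and `φ` is discontinuous at `0`, only `s = 0` is allowed. -/
lemma exists_boundedContinuous_eLpNorm_sub_le_gaussianReal {φ : ℝ → ℝ} (hφm : Measurable φ)
    (hφ : ∀ s : ℝ≥0, MemLp φ 2 (gaussianReal 0 s)) (s₀ : ℝ≥0) {ε : ℝ≥0∞} (hε : ε ≠ 0) :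
    ∃ ψ : BoundedContinuousFunction ℝ ℝ,
      ∀ᶠ s in 𝓝[{s | ContinuousAt φ 0 ∨ 0 < s₀ ∨ s = 0}] s₀,
        eLpNorm (fun x => φ x - ψ x) 2 (gaussianReal 0 s) ≤ ε := by
  rcases eq_or_ne s₀ 0 with rfl | hs₀
  · refine ⟨BoundedContinuousFunction.const ℝ (φ 0), ?_⟩
    by_cases hc : ContinuousAt φ 0
    · exact (ENNReal.tendsto_nhds_zero.1 (tendsto_eLpNorm_sub_const_gaussianReal hφm hφ hc) _
        (pos_iff_ne_zero.2 hε)).filter_mono nhdsWithin_le_nhds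
    · filter_upwards [self_mem_nhdsWithin] with s hs
      have : s = 0 := by simpa [hc] using hs
      subst this
      simp [gaussianReal_zero_var, eLpNorm_dirac]
  · have hpos : 0 < s₀ := pos_iff_ne_zero.2 hs₀
    set C : ℝ≥0 := NNReal.sqrt (2 * s₀ / (s₀ / 2))
    have hC : C ≠ 0 := by simp [C, hs₀]
    have hC' : ((C : ℝ≥0∞) ^ (1 / 2 : ℝ)) ≠ 0 := by simp [hC]
    have hC'' : ((C : ℝ≥0∞) ^ (1 / 2 : ℝ)) ≠ ∞ := by simp
    obtain ⟨ψ, hψ, -⟩ := (hφ (2 * s₀)).exists_boundedContinuous_eLpNorm_sub_le (by norm_num)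
      (ε := ε / (C : ℝ≥0∞) ^ (1 / 2 : ℝ)) (by simp [hε])
    refine ⟨ψ, Filter.Eventually.filter_mono nhdsWithin_le_nhds ?_⟩
    filter_upwards [Icc_mem_nhds (NNReal.half_lt_self hs₀)
      (show s₀ < 2 * s₀ from lt_mul_of_one_lt_left hpos one_lt_two)] with s hs
    refine (eLpNorm_mono_measure _
      (gaussianReal_le_of_le_of_le (half_pos hpos) hs.1 hs.2)).trans ?_
    rw [eLpNorm_smul_measure_of_ne_top (by norm_num)]
    have := mul_le_mul_right hψ ((C : ℝ≥0∞) ^ (1 / 2 : ℝ))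
    rw [ENNReal.mul_div_cancel hC' hC''] at this
    simpa [C] using! this

/-! ### Uniform law of large numbers for Gaussian vectors -/

/-- The covariance matrices admitted in limits towards `S`: the positive semidefinite matrices `K`
such that, if `φ` is discontinuous at `0`, the diagonal entries of `K` vanish where those of `S`
do. Along these, expectations of `φ ⊗ φ` under `N(0, K)` converge to the one under `N(0, S)`. -/
def admissibleCov {ι : Type*} (φ : ℝ → ℝ) (S : Matrix ι ι ℝ) : Set (Matrix ι ι ℝ) :=
  {K | K.PosSemidef ∧ ∀ α, ContinuousAt φ 0 ∨ 0 < S α α ∨ K α α = 0}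

lemma mem_admissibleCov_self {ι : Type*} {φ : ℝ → ℝ} {S : Matrix ι ι ℝ} (hS : S.PosSemidef) :
    S ∈ admissibleCov φ S :=
  ⟨hS, fun α => Or.inr ((hS.diag_nonneg (i := α)).lt_or_eq.imp id Eq.symm)⟩

lemma tendsto_toNNReal_diag {ι : Type*} {φ : ℝ → ℝ} {S : Matrix ι ι ℝ} (α : ι) :
    Tendsto (fun K : Matrix ι ι ℝ => (K α α).toNNReal) (𝓝[admissibleCov φ S] S)
      (𝓝[{s | ContinuousAt φ 0 ∨ 0 < (S α α).toNNReal ∨ s = 0}] (S α α).toNNReal) := by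
  refine tendsto_nhdsWithin_iff.2 ⟨?_, ?_⟩
  · have : Continuous fun K : Matrix ι ι ℝ => (K α α).toNNReal := by fun_prop
    exact (this.tendsto S).mono_left nhdsWithin_le_nhds
  · filter_upwards [self_mem_nhdsWithin] with K hK
    rcases hK.2 α with h | h | h
    · exact Or.inl h
    · exact Or.inr (Or.inl (Real.toNNReal_pos.2 h))
    · exact Or.inr (Or.inr (by simp [h]))

section

variable {ι : Type*} [Fintype ι] [DecidableEq ι]

/-- The centered Gaussian measure with covariance matrix `K`, as a probability measure. -/
noncomputable def centeredGaussian (K : Matrix ι ι ℝ) : ProbabilityMeasure (EuclideanSpace ℝ ι) :=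
  ⟨multivariateGaussian 0 K, inferInstance⟩

/-- Centered Gaussian measures depend weakly continuously on the covariance matrix. -/
lemma tendsto_multivariateGaussian {S : Matrix ι ι ℝ} (hS : S.PosSemidef) :
    Tendsto (centeredGaussian (ι := ι)) (𝓝[{K | K.PosSemidef}] S) (𝓝 (centeredGaussian S)) := by
  have : (𝓝[{K : Matrix ι ι ℝ | K.PosSemidef}] S).IsCountablyGenerated := by
    have : FirstCountableTopology (Matrix ι ι ℝ) :=
      inferInstanceAs (FirstCountableTopology (ι → ι → ℝ))
    infer_instance
  refine tendsto_of_seq_tendsto fun u hu => ?_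
  rw [Function.comp_def, ProbabilityMeasure.tendsto_iff_tendsto_charFun]
  intro t
  simp only [centeredGaussian, ProbabilityMeasure.coe_mk]
  rw [charFun_multivariateGaussian hS]
  have hu1 := tendsto_nhds_of_tendsto_nhdsWithin hu
  have hu2 : ∀ᶠ k in atTop, (u k).PosSemidef := eventually_mem_of_tendsto_nhdsWithin hu
  have hc : Continuous fun K : Matrix ι ι ℝ => Complex.exp
      (((inner ℝ t (0 : EuclideanSpace ℝ ι) : ℝ) : ℂ) * Complex.I -
        ((t.ofLp ⬝ᵥ K.mulVec t.ofLp : ℝ) : ℂ) / 2) := by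
    fun_prop
  refine ((hc.tendsto S).comp hu1).congr' ?_
  filter_upwards [hu2] with k hk
  rw [charFun_multivariateGaussian hk]
  rfl

lemma eLpNorm_eval_multivariateGaussian {f : ℝ → ℝ} (hf : Measurable f) {K : Matrix ι ι ℝ}
    (hK : K.PosSemidef) (α : ι) (p : ℝ≥0∞) :
    eLpNorm (fun h : EuclideanSpace ℝ ι => f (h α)) p (multivariateGaussian 0 K) =
      eLpNorm f p (gaussianReal 0 (K α α).toNNReal) := by
  have := measurePreserving_eval_multivariateGaussian (μ := 0) hK (i := α)
  have h2 := eLpNorm_comp_measurePreserving (p := p) hf.aestronglyMeasurable this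
  simpa [Function.comp_def] using h2

lemma memLp_eval_multivariateGaussian {φ : ℝ → ℝ} (hφm : Measurable φ)
    (hφ : ∀ s : ℝ≥0, MemLp φ 2 (gaussianReal 0 s)) {K : Matrix ι ι ℝ}
    (hK : K.PosSemidef) (α : ι) :
    MemLp (fun h : EuclideanSpace ℝ ι => φ (h α)) 2 (multivariateGaussian 0 K) := by
  refine ⟨(hφm.comp (by fun_prop)).aestronglyMeasurable, ?_⟩
  rw [eLpNorm_eval_multivariateGaussian hφm hK]
  exact (hφ _).2

lemma eLpNorm_boundedContinuous_le {Ω : Type*} [MeasurableSpace Ω] {P : Measure Ω}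
    [IsProbabilityMeasure P] (ψ : BoundedContinuousFunction ℝ ℝ) (X : Ω → ℝ) :
    eLpNorm (fun ω => ψ (X ω)) 2 P ≤ ‖ψ‖ₑ := by
  refine (eLpNorm_le_of_ae_enorm_bound (C := ‖ψ‖ₑ) (.of_forall fun ω => ?_)).trans ?_
  · rw [enorm_le_iff_norm_le]
    exact ψ.norm_coe_le_norm _
  · simp

/-- Local uniform bound for the `L²` norm of `φ` under centered Gaussians. -/
lemma exists_eLpNorm_gaussianReal_le {φ : ℝ → ℝ} (hφm : Measurable φ)
    (hφ : ∀ s : ℝ≥0, MemLp φ 2 (gaussianReal 0 s)) (s₀ : ℝ≥0) :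
    ∃ R : ℝ≥0∞, R ≠ ∞ ∧ ∀ᶠ s in 𝓝[{s | ContinuousAt φ 0 ∨ 0 < s₀ ∨ s = 0}] s₀,
      eLpNorm φ 2 (gaussianReal 0 s) ≤ R := by
  obtain ⟨ψ, hψ⟩ := exists_boundedContinuous_eLpNorm_sub_le_gaussianReal hφm hφ s₀ one_ne_zero
  refine ⟨1 + ‖ψ‖ₑ, by finiteness, ?_⟩
  filter_upwards [hψ] with s hs
  have : φ = (fun x => φ x - ψ x) + fun x => ψ x := by ext; simp
  conv_lhs => rw [this]
  refine (eLpNorm_add_le (by fun_prop) (by fun_prop) (by norm_num)).trans (add_le_add hs ?_)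
  exact eLpNorm_boundedContinuous_le ψ id

/-- Products `φ(h_α) φ(h_α')` are approximated in `L¹(N(0, K))` by bounded continuous functions,
uniformly for admissible `K` near `S`. -/
lemma exists_boundedContinuous_eLpNorm_mul_sub_le {φ : ℝ → ℝ} (hφm : Measurable φ)
    (hφ : ∀ s : ℝ≥0, MemLp φ 2 (gaussianReal 0 s)) (S : Matrix ι ι ℝ) (α α' : ι)
    {ε : ℝ≥0∞} (hε : ε ≠ 0) :
    ∃ g : BoundedContinuousFunction (EuclideanSpace ℝ ι) ℝ, ∀ᶠ K in 𝓝[admissibleCov φ S] S,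
      eLpNorm (fun h : EuclideanSpace ℝ ι => φ (h α) * φ (h α') - g h) 1
        (multivariateGaussian 0 K) ≤ ε := by
  obtain ⟨R, hR, hRα⟩ := exists_eLpNorm_gaussianReal_le hφm hφ (S α α).toNNReal
  obtain ⟨R', hR', hRα'⟩ := exists_eLpNorm_gaussianReal_le hφm hφ (S α' α').toNNReal
  set D : ℝ≥0∞ := R' + (R + 1)
  have hD0 : D ≠ 0 := by simp [D]
  have hD : D ≠ ∞ := by finiteness
  set η : ℝ≥0∞ := min 1 (ε / D)
  have hη : η ≠ 0 := (lt_min one_pos (ENNReal.div_pos hε hD)).ne'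
  obtain ⟨ψ, hψ⟩ := exists_boundedContinuous_eLpNorm_sub_le_gaussianReal hφm hφ (S α α).toNNReal hη
  obtain ⟨ψ', hψ'⟩ :=
    exists_boundedContinuous_eLpNorm_sub_le_gaussianReal hφm hφ (S α' α').toNNReal hη
  have hcα : Continuous fun h : EuclideanSpace ℝ ι => h α := by fun_prop
  have hcα' : Continuous fun h : EuclideanSpace ℝ ι => h α' := by fun_prop
  refine ⟨ψ.compContinuous ⟨_, hcα⟩ * ψ'.compContinuous ⟨_, hcα'⟩, ?_⟩
  filter_upwards [self_mem_nhdsWithin, (tendsto_toNNReal_diag α).eventually hRα,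
    (tendsto_toNNReal_diag α').eventually hRα', (tendsto_toNNReal_diag α).eventually hψ,
    (tendsto_toNNReal_diag α').eventually hψ'] with K hK h1 h2 h3 h4
  rw [← eLpNorm_eval_multivariateGaussian (by fun_prop) hK.1] at h1 h2 h3 h4
  have hm (a : ι) : Measurable fun h : EuclideanSpace ℝ ι => φ (h a) := hφm.comp (by fun_prop)
  have hmψ (χ : BoundedContinuousFunction ℝ ℝ) (a : ι) :
      Measurable fun h : EuclideanSpace ℝ ι => χ (h a) :=
    χ.continuous.measurable.comp (by fun_prop)
  have hψR : eLpNorm (fun h : EuclideanSpace ℝ ι => ψ (h α)) 2 (multivariateGaussian 0 K)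
      ≤ R + 1 := by
    have : (fun h : EuclideanSpace ℝ ι => ψ (h α)) =
        (fun h => φ (h α)) - fun h => φ (h α) - ψ (h α) := by ext; simp
    rw [this]
    exact (eLpNorm_sub_le (hm α).aestronglyMeasurable
      ((hm α).sub (hmψ ψ α)).aestronglyMeasurable (by norm_num)).trans
      (add_le_add h1 (h3.trans (min_le_left _ _)))
  have hsplit : (fun h : EuclideanSpace ℝ ι => φ (h α) * φ (h α') -
      (ψ.compContinuous ⟨_, hcα⟩ * ψ'.compContinuous ⟨_, hcα'⟩) h) =
      ((fun h : EuclideanSpace ℝ ι => φ (h α) - ψ (h α)) •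
          fun h : EuclideanSpace ℝ ι => φ (h α')) +
        (fun h : EuclideanSpace ℝ ι => ψ (h α)) •
          fun h : EuclideanSpace ℝ ι => φ (h α') - ψ' (h α') := by
    ext h
    simp
    ring
  rw [hsplit]
  have e1 : Measurable fun h : EuclideanSpace ℝ ι => φ (h α) - ψ (h α) := (hm α).sub (hmψ ψ α)
  have e2 : Measurable fun h : EuclideanSpace ℝ ι => φ (h α') - ψ' (h α') :=
    (hm α').sub (hmψ ψ' α')
  have hηD : η * D ≤ ε := by
    refine (mul_le_mul_left (min_le_right _ _) D).trans ?_
    rw [ENNReal.div_mul_cancel hD0 hD]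
  refine le_trans ?_ hηD
  refine (eLpNorm_add_le (e1.smul (hm α')).aestronglyMeasurable
    ((hmψ ψ α).smul e2).aestronglyMeasurable le_rfl).trans ?_
  rw [mul_add, mul_comm η (R + 1)]
  refine add_le_add ?_ ?_
  · refine (eLpNorm_smul_le_mul_eLpNorm (p := 2) (q := 2) (hm α').aestronglyMeasurable
      e1.aestronglyMeasurable).trans ?_
    exact mul_le_mul' (h3.trans le_rfl) h2
  · refine (eLpNorm_smul_le_mul_eLpNorm (p := 2) (q := 2) e2.aestronglyMeasurable
      (hmψ ψ α).aestronglyMeasurable).trans ?_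
    exact mul_le_mul' hψR h4

end

/-- Chebyshev's inequality for the average of a bounded function over `c` independent samples. -/
lemma measure_pi_avg_sub_integral_ge_le {E : Type*} [MeasurableSpace E] {N : Measure E}
    [IsProbabilityMeasure N] {g : E → ℝ} (hg : Measurable g) {B : ℝ} (hB : ∀ x, |g x| ≤ B)
    {c : ℕ} (hc : 0 < c) {ε : ℝ} (hε : 0 < ε) :
    Measure.pi (fun _ : Fin c => N) {h | ε ≤ |(c : ℝ)⁻¹ * ∑ i, g (h i) - ∫ x, g x ∂N|} ≤
      ENNReal.ofReal (B ^ 2 / ε ^ 2 / c) := by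
  have hc' : (0 : ℝ) < c := by exact_mod_cast hc
  have hL : MemLp g 2 N := MemLp.of_bound hg.aestronglyMeasurable B (.of_forall hB)
  set P := Measure.pi (fun _ : Fin c => N)
  have hev (i : Fin c) : MeasurePreserving (fun h : Fin c → E => h i) P N :=
    measurePreserving_eval _ i
  have hLi (i : Fin c) : MemLp (fun h : Fin c → E => g (h i)) 2 P :=
    hL.comp_measurePreserving (hev i)
  have hLs : MemLp (∑ i, fun h : Fin c → E => g (h i)) 2 P := memLp_finsetSum' _ fun i _ => hLi i
  have hint : ∫ h, (∑ i, fun h : Fin c → E => g (h i)) h ∂P = c * ∫ x, g x ∂N := by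
    simp only [Finset.sum_apply]
    rw [integral_finsetSum _ fun i _ => (hLi i).integrable (by norm_num)]
    have (i : Fin c) : ∫ h, g (h i) ∂P = ∫ x, g x ∂N := by
      rw [← (hev i).map_eq, integral_map (hev i).measurable.aemeasurable hg.aestronglyMeasurable]
    simp [this]
  have hvar : Var[∑ i, fun h : Fin c → E => g (h i); P] ≤ c * B ^ 2 := by
    rw [variance_sum_pi (X := fun _ => g) fun _ => hL]
    simp only [Finset.sum_const, Finset.card_univ, Fintype.card_fin, nsmul_eq_mul]
    gcongr
    refine (variance_le_expectation_sq hg.aestronglyMeasurable).trans ?_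
    refine (integral_mono hL.integrable_sq (integrable_const (B ^ 2)) fun x => ?_).trans (by simp)
    simpa using sq_le_sq' (by linarith [abs_le.1 (hB x)]) (abs_le.1 (hB x)).2
  refine (measure_mono ?_).trans ((meas_ge_le_variance_div_sq hLs
    (mul_pos hc' hε)).trans (ENNReal.ofReal_le_ofReal ?_))
  · intro h hh
    simp only [Set.mem_ofPred_eq] at hh ⊢
    rw [hint]
    simp only [Finset.sum_apply]
    have : ∑ i, g (h i) - c * ∫ x, g x ∂N =
        c * ((c : ℝ)⁻¹ * ∑ i, g (h i) - ∫ x, g x ∂N) := by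
      field_simp
    rw [this, abs_mul, abs_of_pos hc']
    gcongr
  · rw [div_div, div_le_div_iff₀ (by positivity) (by positivity)]
    calc Var[∑ i, fun h : Fin c → E => g (h i); P] * (ε ^ 2 * c)
        ≤ c * B ^ 2 * (ε ^ 2 * c) := by gcongr
      _ = B ^ 2 * (c * ε) ^ 2 := by ring

/-- Markov's inequality for the average of a function over `c` independent samples. -/
lemma measure_pi_avg_abs_ge_le {E : Type*} [MeasurableSpace E] {N : Measure E}
    [IsProbabilityMeasure N] {d : E → ℝ} (hd : Measurable d) {c : ℕ} (hc : 0 < c)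
    {ε : ℝ} (hε : 0 < ε) :
    Measure.pi (fun _ : Fin c => N) {h | ε ≤ |(c : ℝ)⁻¹ * ∑ i, d (h i)|} ≤
      eLpNorm d 1 N / ENNReal.ofReal ε := by
  have hc' : (0 : ℝ) < c := by exact_mod_cast hc
  set P := Measure.pi (fun _ : Fin c => N)
  have hev (i : Fin c) : MeasurePreserving (fun h : Fin c → E => h i) P N :=
    measurePreserving_eval _ i
  have hbound : ∫⁻ h, ‖(c : ℝ)⁻¹ * ∑ i, d (h i)‖ₑ ∂P ≤ eLpNorm d 1 N := by
    calc ∫⁻ h, ‖(c : ℝ)⁻¹ * ∑ i, d (h i)‖ₑ ∂P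
        ≤ ∫⁻ h, (c : ℝ≥0∞)⁻¹ * ∑ i, ‖d (h i)‖ₑ ∂P := by
          refine lintegral_mono fun h => ?_
          rw [enorm_mul]
          refine mul_le_mul' (le_of_eq ?_) (enorm_sum_le _ _)
          rw [enorm_inv hc'.ne', Real.enorm_natCast]
      _ = (c : ℝ≥0∞)⁻¹ * ∑ i : Fin c, ∫⁻ h, ‖d (h i)‖ₑ ∂P := by
          rw [lintegral_const_mul _ (by fun_prop), lintegral_finsetSum _ (by fun_prop)]
      _ = (c : ℝ≥0∞)⁻¹ * ∑ i : Fin c, eLpNorm d 1 N := by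
          congr 1
          refine Finset.sum_congr rfl fun i _ => ?_
          rw [(hev i).lintegral_comp (f := fun x => ‖d x‖ₑ) (by fun_prop),
            eLpNorm_one_eq_lintegral_enorm]
      _ = eLpNorm d 1 N := by
          simp only [Finset.sum_const, Finset.card_univ, Fintype.card_fin, nsmul_eq_mul]
          rw [← mul_assoc, ENNReal.inv_mul_cancel (by exact_mod_cast hc.ne') (by simp), one_mul]
  have := mul_meas_ge_le_lintegral₀ (μ := P) (f := fun h => ‖(c : ℝ)⁻¹ * ∑ i, d (h i)‖ₑ)
    (((Finset.measurable_fun_sum _ fun i _ => hd.comp (measurable_pi_apply i)).const_mul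
      _).enorm.aemeasurable) (ENNReal.ofReal ε)
  rw [ENNReal.le_div_iff_mul_le (by simp [hε]) (by simp), mul_comm]
  refine le_trans (mul_le_mul_right (measure_mono fun h hh => ?_) _) (this.trans hbound)
  simp only [Set.mem_ofPred_eq] at hh ⊢
  rw [Real.enorm_eq_ofReal_abs]
  exact ENNReal.ofReal_le_ofReal hh

/-- Law of large numbers for the empirical second moments of `φ`, uniform over admissible
covariances `K` near `S`. -/
lemma eventually_measure_pi_avg_le {ι : Type*} [Fintype ι] [DecidableEq ι] {φ : ℝ → ℝ}
    (hφm : Measurable φ) (hφ : ∀ s : ℝ≥0, MemLp φ 2 (gaussianReal 0 s)) {S : Matrix ι ι ℝ}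
    (hS : S.PosSemidef) (α α' : ι) {ε : ℝ} (hε : 0 < ε) {δ : ℝ≥0∞} (hδ : δ ≠ 0) :
    ∀ᶠ p : ℕ × Matrix ι ι ℝ in atTop ×ˢ 𝓝[admissibleCov φ S] S,
      Measure.pi (fun _ : Fin p.1 => multivariateGaussian 0 p.2)
        {h | ε ≤ |(p.1 : ℝ)⁻¹ * ∑ i, φ (h i α) * φ (h i α') -
          ∫ z, φ (z α) * φ (z α') ∂(multivariateGaussian 0 S)|} ≤ δ := by
  have hε4 : 0 < ε / 4 := by positivity
  have hδ2 : δ / 2 ≠ 0 := (ENNReal.half_pos hδ).ne'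
  set η : ℝ≥0∞ := min (ENNReal.ofReal (ε / 4)) (δ / 2 * ENNReal.ofReal (ε / 4))
  have hη : η ≠ 0 := by
    refine (lt_min (by simpa using hε) (pos_iff_ne_zero.2 (mul_ne_zero hδ2 ?_))).ne'
    simpa using hε
  obtain ⟨g, hg⟩ := exists_boundedContinuous_eLpNorm_mul_sub_le hφm hφ S α α' hη
  have hweak : ∀ᶠ K in 𝓝[admissibleCov φ S] S,
      |∫ z, g z ∂(multivariateGaussian 0 K) - ∫ z, g z ∂(multivariateGaussian 0 S)| < ε / 4 := by
    have h1 := (ProbabilityMeasure.tendsto_iff_forall_integral_tendsto.1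
      (tendsto_multivariateGaussian hS)) g
    have h2 := h1.mono_left (nhdsWithin_mono S (t := {K | K.PosSemidef})
      (s := admissibleCov φ S) fun K hK => hK.1)
    simpa [Real.dist_eq, centeredGaussian] using (Metric.tendsto_nhds.1 h2) (ε / 4) hε4
  have hself := hg.self_of_nhdsWithin (mem_admissibleCov_self hS)
  have hmφ : Measurable fun h : EuclideanSpace ℝ ι => φ (h α) * φ (h α') :=
    (hφm.comp (by fun_prop)).mul (hφm.comp (by fun_prop))
  have hlim : |∫ z, g z ∂(multivariateGaussian 0 S) -
      ∫ z, φ (z α) * φ (z α') ∂(multivariateGaussian 0 S)| ≤ ε / 4 := by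
    have hi1 : Integrable (fun z : EuclideanSpace ℝ ι => φ (z α) * φ (z α'))
        (multivariateGaussian 0 S) :=
      (memLp_eval_multivariateGaussian hφm hφ hS α).integrable_mul
        (memLp_eval_multivariateGaussian hφm hφ hS α')
    have hi2 : Integrable (fun z => g z) (multivariateGaussian 0 S) := g.integrable _
    rw [abs_sub_comm, ← integral_sub hi1 hi2, ← Real.norm_eq_abs]
    have := (enorm_integral_le_lintegral_enorm (μ := multivariateGaussian 0 S)
      fun z : EuclideanSpace ℝ ι => φ (z α) * φ (z α') - g z)
    rw [← eLpNorm_one_eq_lintegral_enorm] at this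
    have h3 := this.trans (hself.trans (min_le_left _ _))
    rwa [← ofReal_norm, ENNReal.ofReal_le_ofReal_iff hε4.le] at h3
  have hB : Tendsto (fun c : ℕ => ENNReal.ofReal (‖g‖ ^ 2 / (ε / 4) ^ 2 / c)) atTop (𝓝 0) := by
    rw [← ENNReal.ofReal_zero]
    exact ENNReal.tendsto_ofReal (tendsto_const_div_atTop_nhds_zero_nat _)
  filter_upwards [((eventually_gt_atTop 0).and
    (ENNReal.tendsto_nhds_zero.1 hB _ (pos_iff_ne_zero.2 hδ2))).prod_mk (hg.and hweak)]
    with ⟨c, K⟩ ⟨⟨hc, hcB⟩, hK, hKw⟩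
  simp only at hc hcB hK hKw ⊢
  rw [← ENNReal.add_halves δ]
  refine (measure_mono (t := {h | ε / 4 ≤ |(c : ℝ)⁻¹ * ∑ i, (φ (h i α) * φ (h i α') - g (h i))|} ∪
    {h | ε / 4 ≤ |(c : ℝ)⁻¹ * ∑ i, g (h i) - ∫ z, g z ∂(multivariateGaussian 0 K)|}) ?_).trans
    ((measure_union_le _ _).trans (add_le_add ?_ ?_))
  · intro h hh
    by_contra hcon
    simp only [Set.mem_ofPred_eq, Set.mem_union, not_or, not_le, Finset.sum_sub_distrib,
      mul_sub] at hcon hh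
    obtain ⟨h1, h2⟩ := hcon
    rw [abs_lt] at h1 h2 hKw
    rw [abs_le] at hlim
    refine absurd hh (not_le.2 (abs_lt.2 ⟨?_, ?_⟩)) <;> linarith [h1.1, h1.2]
  · refine (measure_pi_avg_abs_ge_le (N := multivariateGaussian 0 K)
      (d := fun z : EuclideanSpace ℝ ι => φ (z α) * φ (z α') - g z)
      (hmφ.sub g.continuous.measurable) hc hε4).trans ?_
    refine ENNReal.div_le_of_le_mul (hK.trans (min_le_right _ _))
  · exact (measure_pi_avg_sub_integral_ge_le g.continuous.measurable
      (fun x => g.norm_coe_le_norm x) hc hε4).trans hcB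

/-! ### Conditional law of a convolutional layer -/

/-- The empirical second-moment matrix `c⁻¹ ∑ᵢ xᵢ xᵢᵀ` over the channels of `x`. -/
noncomputable def channelGram {n c : ℕ} (x : Fin c → ZMod n → ℝ) : Matrix (ZMod n) (ZMod n) ℝ :=
  Matrix.of fun α α' => (c : ℝ)⁻¹ * ∑ i, x i α * x i α'

/-- The covariance matrix of each output channel of a random convolutional layer with fixed
input `x`. -/
noncomputable def layerCov {n k c : ℕ} (v : Ker k → ℝ) (σw σb : ℝ) (x : Fin c → ZMod n → ℝ) :
    Matrix (ZMod n) (ZMod n) ℝ :=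
  crossCorr v (affineCov σw σb (channelGram x))

section PosSemidef

variable {n k : ℕ}

lemma posSemidef_channelGram [NeZero n] {c : ℕ} (x : Fin c → ZMod n → ℝ) :
    (channelGram x).PosSemidef := by
  have : channelGram x = (c : ℝ)⁻¹ • ((Matrix.of x).conjTranspose * Matrix.of x) := by
    ext α α'
    simp [channelGram, Matrix.mul_apply]
  rw [this]
  exact (Matrix.posSemidef_conjTranspose_mul_self _).smul (by positivity)

lemma posSemidef_affineCov [NeZero n] (σw σb : ℝ) {M : Matrix (ZMod n) (ZMod n) ℝ}
    (hM : M.PosSemidef) :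
    (affineCov σw σb M).PosSemidef := by
  have : affineCov σw σb M = σw ^ 2 • M + σb ^ 2 • Matrix.vecMulVec 1 (star 1) := by
    ext α α'
    simp [affineCov]
  rw [this]
  exact (hM.smul (sq_nonneg _)).add ((Matrix.posSemidef_vecMulVec_self_star _).smul (sq_nonneg _))

lemma posSemidef_crossCorr {v : Ker k → ℝ} (hv : ∀ β, 0 ≤ v β)
    {M : Matrix (ZMod n) (ZMod n) ℝ} (hM : M.PosSemidef) : (crossCorr v M).PosSemidef := by
  have : crossCorr v M = ∑ β : Ker k, v β •
      M.submatrix (fun α => α + ((β : ℤ) : ZMod n)) (fun α => α + ((β : ℤ) : ZMod n)) := by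
    ext α α'
    simp [crossCorr, Matrix.sum_apply]
  rw [this]
  exact Matrix.posSemidef_sum _ fun β _ => (hM.submatrix _).smul (hv β)

lemma posSemidef_layerCov [NeZero n] {c : ℕ} {v : Ker k → ℝ} (hv : ∀ β, 0 ≤ v β) (σw σb : ℝ)
    (x : Fin c → ZMod n → ℝ) : (layerCov v σw σb x).PosSemidef :=
  posSemidef_crossCorr hv (posSemidef_affineCov _ _ (posSemidef_channelGram x))

end PosSemidef

section LayerLaw

variable {n k c : ℕ} [NeZero n] {v : Ker k → ℝ} {σw σb : ℝ}

lemma dotProduct_layerCov_mulVec (hv1 : ∑ β, v β = 1) (x : Fin c → ZMod n → ℝ)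
    (t : ZMod n → ℝ) :
    t ⬝ᵥ (layerCov v σw σb x).mulVec t =
      (∑ i, ∑ β : Ker k, v β * σw ^ 2 / c * (∑ α, t α * x i (α + ((β : ℤ) : ZMod n))) ^ 2) +
        σb ^ 2 * (∑ α, t α) ^ 2 := by
  have hsq (f : ZMod n → ℝ) : (∑ α, f α) ^ 2 = ∑ α, ∑ α', f α * f α' := by
    rw [sq, Finset.sum_mul_sum]
  have hK (α α' : ZMod n) : layerCov v σw σb x α α' =
      (∑ i, ∑ β : Ker k, v β * σw ^ 2 / c *
        (x i (α + ((β : ℤ) : ZMod n)) * x i (α' + ((β : ℤ) : ZMod n)))) + σb ^ 2 := by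
    simp only [layerCov, crossCorr, affineCov, channelGram, Matrix.of_apply, mul_add,
      Finset.sum_add_distrib]
    rw [← Finset.sum_mul, hv1, one_mul, Finset.sum_comm (s := (Finset.univ : Finset (Fin c)))]
    congr 1
    refine Finset.sum_congr rfl fun β _ => ?_
    simp only [Finset.mul_sum]
    refine Finset.sum_congr rfl fun i _ => ?_
    ring
  simp only [dotProduct, Matrix.mulVec, hsq, hK, Finset.mul_sum, add_mul, mul_add,
    Finset.sum_add_distrib, Finset.sum_mul]
  congr 1
  · rw [Finset.sum_congr rfl fun α _ => Finset.sum_comm, Finset.sum_comm]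
    refine Finset.sum_congr rfl fun i _ => ?_
    rw [Finset.sum_congr rfl fun α _ => Finset.sum_comm, Finset.sum_comm]
    refine Finset.sum_congr rfl fun β _ => Finset.sum_congr rfl fun α _ =>
      Finset.sum_congr rfl fun α' _ => ?_
    ring
  · refine Finset.sum_congr rfl fun α _ => Finset.sum_congr rfl fun α' _ => ?_
    ring

/-- For a fixed input, the output channels of a Gaussian convolutional layer are i.i.d. centered
Gaussian vectors with covariance `layerCov`. -/
lemma map_convLayer_eq_pi {Ω : Type*} [MeasurableSpace Ω] {P : Measure Ω} [IsProbabilityMeasure P]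
    (hv : ∀ β, 0 ≤ v β) (hv1 : ∑ β, v β = 1) {w : Fin c → Fin c → Ker k → Ω → ℝ}
    {b : Fin c → Ω → ℝ}
    (hw : ∀ i j β, HasLaw (w i j β) (gaussianReal 0 (v β * σw ^ 2 / c).toNNReal) P)
    (hb : ∀ j, HasLaw (b j) (gaussianReal 0 (σb ^ 2).toNNReal) P)
    (hind : iIndepFun (Sum.elim (fun p : Fin c × Fin c × Ker k => w p.1 p.2.1 p.2.2) b) P)
    (x : Fin c → ZMod n → ℝ) :
    P.map (fun ω j => (WithLp.toLp 2 (convLayer x (fun i j β => w i j β ω) (fun j => b j ω) j) :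
      EuclideanSpace ℝ (ZMod n))) =
      Measure.pi fun _ : Fin c => multivariateGaussian 0 (layerCov v σw σb x) := by
  have hwm (i j β) : AEMeasurable (w i j β) P := (hw i j β).aemeasurable
  have hbm (j) : AEMeasurable (b j) P := (hb j).aemeasurable
  have hHm : AEMeasurable (fun ω j => (WithLp.toLp 2
      (convLayer x (fun i j β => w i j β ω) (fun j => b j ω) j) :
        EuclideanSpace ℝ (ZMod n))) P := by
    refine aemeasurable_pi_lambda _ fun j => ?_
    refine (WithLp.measurable_toLp 2 (ZMod n → ℝ)).comp_aemeasurable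
      (aemeasurable_pi_lambda _ fun α => ?_)
    unfold convLayer
    fun_prop
  refine charFun_eq_pi_iff.1 fun t => ?_
  rw [AEMeasurable.map_map_of_aemeasurable (by fun_prop) hHm]
  -- the pairing of the output with `t` is the linear combination of weights and biases below
  set a : (Fin c × Fin c × Ker k) ⊕ Fin c → ℝ :=
    Sum.elim (fun p => ∑ α, t p.2.1 α * x p.1 (α + ((p.2.2 : ℤ) : ZMod n))) (fun j => ∑ α, t j α)
    with ha
  set Z : (Fin c × Fin c × Ker k) ⊕ Fin c → Ω → ℝ :=
    Sum.elim (fun p : Fin c × Fin c × Ker k => w p.1 p.2.1 p.2.2) b with hZ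
  set s : (Fin c × Fin c × Ker k) ⊕ Fin c → ℝ :=
    Sum.elim (fun p => v p.2.2 * σw ^ 2 / c) (fun _ => σb ^ 2) with hs
  have hs0 (q) : 0 ≤ s q := by
    rcases q with p | j
    · simp only [hs, Sum.elim_inl]
      have := hv p.2.2
      positivity
    · simp only [hs, Sum.elim_inr]
      positivity
  have hZlaw (q) : HasLaw (Z q) (gaussianReal 0 (s q).toNNReal) P := by
    rcases q with p | j
    · exact hw _ _ _
    · exact hb _
  have hpair (ω : Ω) : inner ℝ (WithLp.toLp 2 fun j => (WithLp.toLp 2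
      (convLayer x (fun i j β => w i j β ω) (fun j => b j ω) j) : EuclideanSpace ℝ (ZMod n))) t =
      ∑ q, a q * Z q ω := by
    rw [Fintype.sum_sum_type]
    simp only [PiLp.inner_apply, convLayer, ha, hZ, Sum.elim_inl, Sum.elim_inr,
      Fintype.sum_prod_type, RCLike.inner_apply, conj_trivial, mul_add, Finset.sum_add_distrib,
      Finset.sum_mul, Finset.mul_sum]
    congr 1
    rw [Finset.sum_comm (s := (Finset.univ : Finset (Fin c))) (t := Finset.univ)
      (f := fun i j => ∑ β : Ker k, ∑ α, t j α * x i (α + ((β : ℤ) : ZMod n)) * w i j β ω)]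
    refine Finset.sum_congr rfl fun j _ => ?_
    rw [Finset.sum_comm]
    refine Finset.sum_congr rfl fun i _ => ?_
    rw [Finset.sum_comm]
    refine Finset.sum_congr rfl fun β _ => Finset.sum_congr rfl fun α _ => ?_
    ring
  have hchar : charFun (P.map ((WithLp.toLp 2) ∘ fun ω j => (WithLp.toLp 2
      (convLayer x (fun i j β => w i j β ω) (fun j => b j ω) j) : EuclideanSpace ℝ (ZMod n)))) t =
      charFun (P.map fun ω => ∑ q, a q * Z q ω) 1 := by
    rw [charFun_apply, charFun_apply,
      integral_map ((WithLp.measurable_toLp 2 _).comp_aemeasurable hHm) (by fun_prop),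
      integral_map (Finset.aemeasurable_fun_sum _ fun q _ =>
        (hZlaw q).aemeasurable.const_mul _) (by fun_prop)]
    refine integral_congr_ae (.of_forall fun ω => ?_)
    simp only [Function.comp_apply, hpair]
    simp
  have hlaw (q) := gaussianReal_const_mul (hZlaw q) (a q)
  have hind' : iIndepFun (fun q ω => a q * Z q ω) P :=
    hind.comp (fun q y => a q * y) fun q => by fun_prop
  rw [hchar, hind'.charFun_map_fun_sum_eq_prod fun q => (hlaw q).aemeasurable, Finset.prod_apply]
  simp only [(hlaw _).map_eq, charFun_gaussianReal,
    charFun_multivariateGaussian (posSemidef_layerCov hv σw σb x)]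
  rw [← Complex.exp_sum, ← Complex.exp_sum]
  congr 1
  have hreal : ∑ q, s q * a q ^ 2 =
      ∑ j, (t j).ofLp ⬝ᵥ (layerCov v σw σb x).mulVec (t j).ofLp := by
    simp only [dotProduct_layerCov_mulVec hv1, Fintype.sum_sum_type, hs, ha, Sum.elim_inl,
      Sum.elim_inr, Fintype.sum_prod_type, Finset.sum_add_distrib]
    congr 1
    exact Finset.sum_comm
  have h1 (q) : (((1 : ℝ) : ℂ) * ((a q * 0 : ℝ) : ℂ) * Complex.I -
      (((NNReal.mk (a q ^ 2) (sq_nonneg _) * (s q).toNNReal : ℝ≥0) : ℝ) : ℂ) *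
        ((1 : ℝ) : ℂ) ^ 2 / 2) = -((s q * a q ^ 2 : ℝ) : ℂ) / 2 := by
    have : ((NNReal.mk (a q ^ 2) (sq_nonneg _) * (s q).toNNReal : ℝ≥0) : ℝ) = s q * a q ^ 2 := by
      rw [NNReal.coe_mul, Real.coe_toNNReal _ (hs0 q), mul_comm]
      rfl
    rw [this]
    simp [neg_div]
  rw [Finset.sum_congr rfl fun q _ => h1 q, ← Finset.sum_div, Finset.sum_neg_distrib,
    ← Complex.ofReal_sum, hreal]
  simp [neg_div, Finset.sum_div]

end LayerLaw

/-! ### Conditioning on the previous layer -/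

section Measurability

variable {n k c : ℕ}

@[fun_prop]
lemma measurable_convLayer : Measurable fun p : (Fin c → ZMod n → ℝ) ×
    (Fin c → Fin c → Ker k → ℝ) × (Fin c → ℝ) => convLayer p.1 p.2.1 p.2.2 := by
  unfold convLayer
  fun_prop

lemma measurable_postAct {φ : ℝ → ℝ} (hφm : Measurable φ) (x0 : Fin c → ZMod n → ℝ) (l : ℕ) :
    Measurable fun p : (ℕ → Fin c → Fin c → Ker k → ℝ) × (ℕ → Fin c → ℝ) =>
      postAct φ x0 p.1 p.2 l := by
  induction l with
  | zero => exact measurable_const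
  | succ l ih =>
    have h0 : Measurable fun p : (ℕ → Fin c → Fin c → Ker k → ℝ) × (ℕ → Fin c → ℝ) =>
        (postAct φ x0 p.1 p.2 l, p.1 (l + 1), p.2 (l + 1)) := by fun_prop
    have h1 := measurable_convLayer.comp h0
    have hφ' : Measurable fun (y : Fin c → ZMod n → ℝ) (j : Fin c) (α : ZMod n) => φ (y j α) := by
      fun_prop
    exact hφ'.comp h1

/-- The post-activations of layer `l` depend on the parameters of the layers up to `l` only. -/
lemma postAct_congr {φ : ℝ → ℝ} (x0 : Fin c → ZMod n → ℝ)
    {w w' : ℕ → Fin c → Fin c → Ker k → ℝ} {b b' : ℕ → Fin c → ℝ} {l : ℕ}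
    (hw : ∀ i ≤ l, w i = w' i) (hb : ∀ i ≤ l, b i = b' i) :
    postAct φ x0 w b l = postAct φ x0 w' b' l := by
  induction l with
  | zero => rfl
  | succ l ih =>
    simp only [postAct]
    rw [ih (fun i hi => hw i (by omega)) (fun i hi => hb i (by omega)), hw _ le_rfl, hb _ le_rfl]

lemma continuous_affineCov (σw σb : ℝ) :
    Continuous fun M : Matrix (ZMod n) (ZMod n) ℝ => affineCov σw σb M := by
  refine continuous_matrix fun α α' => ?_
  simp only [affineCov, Matrix.of_apply]
  fun_prop

lemma continuous_crossCorr (v : Ker k → ℝ) :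
    Continuous fun M : Matrix (ZMod n) (ZMod n) ℝ => crossCorr v M := by
  refine continuous_matrix fun α α' => ?_
  simp only [crossCorr, Matrix.of_apply]
  fun_prop

lemma measurable_layerCov_apply (v : Ker k → ℝ) (σw σb : ℝ) (α α' : ZMod n) :
    Measurable fun x : Fin c → ZMod n → ℝ => layerCov v σw σb x α α' := by
  simp only [layerCov, crossCorr, affineCov, channelGram, Matrix.of_apply]
  fun_prop

end Measurability

section Disintegration

variable {n k c : ℕ} {v : Ker k → ℝ} {σw σb : ℝ} {Ω : Type*} [MeasurableSpace Ω]
  {P : Measure Ω} {w : ℕ → Fin c → Fin c → Ker k → Ω → ℝ}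
  {b : ℕ → Fin c → Ω → ℝ}

/-- The pre-activations of layer `l + 1` as a random family of Euclidean vectors. -/
noncomputable def preActVec (φ : ℝ → ℝ) (x0 : Fin c → ZMod n → ℝ)
    (w : ℕ → Fin c → Fin c → Ker k → Ω → ℝ) (b : ℕ → Fin c → Ω → ℝ) (l : ℕ) (ω : Ω) :
    Fin c → EuclideanSpace ℝ (ZMod n) :=
  fun j => WithLp.toLp 2
    (nextPreAct φ x0 (fun l i j β => w l i j β ω) (fun l j => b l j ω) l j)

/-- The post-activations of layer `l` as a random family. -/
noncomputable def postActRV (φ : ℝ → ℝ) (x0 : Fin c → ZMod n → ℝ)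
    (w : ℕ → Fin c → Fin c → Ker k → Ω → ℝ) (b : ℕ → Fin c → Ω → ℝ) (l : ℕ) (ω : Ω) :
    Fin c → ZMod n → ℝ :=
  postAct φ x0 (fun l i j β => w l i j β ω) (fun l j => b l j ω) l

lemma IsGaussianInit.aemeasurable_postActRV (hinit : IsGaussianInit P v σw σb w b) {φ : ℝ → ℝ}
    (hφm : Measurable φ) (x0 : Fin c → ZMod n → ℝ) (l : ℕ) :
    AEMeasurable (postActRV φ x0 w b l) P := by
  have hw (l i j β) : AEMeasurable (w l i j β) P := (hinit.weight_law l i j β).aemeasurable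
  have hb (l j) : AEMeasurable (b l j) P := (hinit.bias_law l j).aemeasurable
  exact (measurable_postAct hφm x0 l).comp_aemeasurable
    (f := fun ω => (fun l i j β => w l i j β ω, fun l j => b l j ω)) (by fun_prop)

/-- The inputs of a layer are independent of its parameters. -/
lemma IsGaussianInit.indepFun_postActRV (hinit : IsGaussianInit P v σw σb w b) {φ : ℝ → ℝ}
    (hφm : Measurable φ) (x0 : Fin c → ZMod n → ℝ) (l : ℕ) :
    IndepFun (postActRV φ x0 w b l)
      (fun ω => ((fun i j β => w (l + 1) i j β ω, fun j => b (l + 1) j ω) :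
        (Fin c → Fin c → Ker k → ℝ) × (Fin c → ℝ))) P := by
  classical
  have hw (l i j β) : AEMeasurable (w l i j β) P := (hinit.weight_law l i j β).aemeasurable
  have hb (l j) : AEMeasurable (b l j) P := (hinit.bias_law l j).aemeasurable
  set Z : (ℕ × Fin c × Fin c × Ker k) ⊕ (ℕ × Fin c) → Ω → ℝ :=
    Sum.elim (fun p : ℕ × Fin c × Fin c × Ker k => w p.1 p.2.1 p.2.2.1 p.2.2.2)
      (fun q : ℕ × Fin c => b q.1 q.2) with hZ
  have hZm (q) : AEMeasurable (Z q) P := by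
    rcases q with q | q
    · exact hw _ _ _ _
    · exact hb _ _
  set S : Finset ((ℕ × Fin c × Fin c × Ker k) ⊕ (ℕ × Fin c)) :=
    ((Finset.range (l + 1)) ×ˢ Finset.univ).disjSum ((Finset.range (l + 1)) ×ˢ Finset.univ) with hS
  set T : Finset ((ℕ × Fin c × Fin c × Ker k) ⊕ (ℕ × Fin c)) :=
    ({l + 1} ×ˢ Finset.univ).disjSum ({l + 1} ×ˢ Finset.univ) with hT
  have hSl (q) : Sum.inl q ∈ S ↔ q.1 ≤ l := by simp [hS]
  have hSr (q) : Sum.inr q ∈ S ↔ q.1 ≤ l := by simp [hS]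
  have hTl (q) : Sum.inl q ∈ T ↔ q.1 = l + 1 := by
    simp only [hT, Finset.inl_mem_disjSum, Finset.mem_product, Finset.mem_singleton,
      Finset.mem_univ, and_true]
  have hTr (q) : Sum.inr q ∈ T ↔ q.1 = l + 1 := by
    simp only [hT, Finset.inr_mem_disjSum, Finset.mem_product, Finset.mem_singleton,
      Finset.mem_univ, and_true]
  have hST : Disjoint S T := by
    rw [Finset.disjoint_left]
    rintro (q | q) h1 h2
    · rw [hSl] at h1; rw [hTl] at h2; omega
    · rw [hSr] at h1; rw [hTr] at h2; omega
  have hind := hinit.indep.indepFun_finset₀ S T hST hZm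
  -- parameters of the layers up to `l`, extended by zero to all layers
  let eS (y : S → ℝ) : (ℕ → Fin c → Fin c → Ker k → ℝ) × (ℕ → Fin c → ℝ) :=
    (fun m i j β => if h : Sum.inl (m, i, j, β) ∈ S then y ⟨_, h⟩ else 0,
      fun m j => if h : Sum.inr (m, j) ∈ S then y ⟨_, h⟩ else 0)
  have heS : Measurable eS := by
    refine Measurable.prodMk (measurable_pi_lambda _ fun m => measurable_pi_lambda _ fun i =>
      measurable_pi_lambda _ fun j => measurable_pi_lambda _ fun β => ?_)
      (measurable_pi_lambda _ fun m => measurable_pi_lambda _ fun j => ?_)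
    · split_ifs <;> fun_prop
    · split_ifs <;> fun_prop
  let eT (y : T → ℝ) : (Fin c → Fin c → Ker k → ℝ) × (Fin c → ℝ) :=
    (fun i j β => y ⟨Sum.inl (l + 1, i, j, β), (hTl _).2 rfl⟩,
      fun j => y ⟨Sum.inr (l + 1, j), (hTr _).2 rfl⟩)
  have heT : Measurable eT := by fun_prop
  have h2 := hind.comp ((measurable_postAct hφm x0 l).comp heS) heT
  refine h2.congr (.of_forall fun ω => Eq.symm ?_) (.of_forall fun ω => rfl)
  refine postAct_congr x0 (fun m hm => ?_) (fun m hm => ?_)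
  · funext i j β
    simp only [eS, dif_pos ((hSl (m, i, j, β)).2 hm)]
    rfl
  · funext j
    simp only [eS, dif_pos ((hSr (m, j)).2 hm)]
    rfl

lemma IsGaussianInit.aemeasurable_preActVec (hinit : IsGaussianInit P v σw σb w b) {φ : ℝ → ℝ}
    (hφm : Measurable φ) (x0 : Fin c → ZMod n → ℝ) (l : ℕ) :
    AEMeasurable (preActVec φ x0 w b l) P := by
  have hw (l i j β) : AEMeasurable (w l i j β) P := (hinit.weight_law l i j β).aemeasurable
  have hb (l j) : AEMeasurable (b l j) P := (hinit.bias_law l j).aemeasurable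
  have h1 : AEMeasurable (fun ω => nextPreAct φ x0 (fun l i j β => w l i j β ω)
      (fun l j => b l j ω) l) P :=
    measurable_convLayer.comp_aemeasurable (f := fun ω => (postActRV φ x0 w b l ω,
      (fun i j β => w (l + 1) i j β ω, fun j => b (l + 1) j ω)))
      ((hinit.aemeasurable_postActRV hφm x0 l).prodMk (by fun_prop))
  exact aemeasurable_pi_lambda _ fun j => (WithLp.measurable_toLp 2 _).comp_aemeasurable
    ((measurable_pi_apply j).comp_aemeasurable h1)

/-- The law of the parameters of layer `l + 1`. -/
noncomputable def layerParamLaw (P : Measure Ω) (w : ℕ → Fin c → Fin c → Ker k → Ω → ℝ)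
    (b : ℕ → Fin c → Ω → ℝ) (l : ℕ) : Measure ((Fin c → Fin c → Ker k → ℝ) × (Fin c → ℝ)) :=
  P.map fun ω => (fun i j β => w (l + 1) i j β ω, fun j => b (l + 1) j ω)

lemma IsGaussianInit.aemeasurable_layerParam (hinit : IsGaussianInit P v σw σb w b) (l : ℕ) :
    AEMeasurable (fun ω => ((fun i j β => w (l + 1) i j β ω, fun j => b (l + 1) j ω) :
        (Fin c → Fin c → Ker k → ℝ) × (Fin c → ℝ))) P := by
  have hw (l i j β) : AEMeasurable (w l i j β) P := (hinit.weight_law l i j β).aemeasurable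
  have hb (l j) : AEMeasurable (b l j) P := (hinit.bias_law l j).aemeasurable
  fun_prop

lemma measurable_convLayerVec : Measurable fun p : (Fin c → ZMod n → ℝ) ×
    (Fin c → Fin c → Ker k → ℝ) × (Fin c → ℝ) => (fun j => WithLp.toLp 2
      (convLayer p.1 p.2.1 p.2.2 j) : Fin c → EuclideanSpace ℝ (ZMod n)) :=
  measurable_pi_lambda _ fun j => (WithLp.measurable_toLp 2 _).comp
    ((measurable_pi_apply j).comp measurable_convLayer)

variable [NeZero n] [IsProbabilityMeasure P]

lemma IsGaussianInit.map_layerParamLaw (hinit : IsGaussianInit P v σw σb w b)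
    (hv : ∀ β, 0 ≤ v β) (hv1 : ∑ β, v β = 1) (l : ℕ) (x : Fin c → ZMod n → ℝ) :
    (layerParamLaw P w b l).map (fun θ => (fun j => WithLp.toLp 2
      (convLayer x θ.1 θ.2 j) : Fin c → EuclideanSpace ℝ (ZMod n))) =
      Measure.pi fun _ : Fin c => multivariateGaussian 0 (layerCov v σw σb x) := by
  have hm : Measurable fun θ : (Fin c → Fin c → Ker k → ℝ) × (Fin c → ℝ) => (fun j =>
      WithLp.toLp 2 (convLayer x θ.1 θ.2 j) : Fin c → EuclideanSpace ℝ (ZMod n)) :=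
    measurable_convLayerVec.comp (f := fun θ => (x, θ)) (by fun_prop)
  rw [layerParamLaw, AEMeasurable.map_map_of_aemeasurable hm.aemeasurable
    (hinit.aemeasurable_layerParam l)]
  refine map_convLayer_eq_pi hv hv1 (w := w (l + 1)) (b := b (l + 1))
    (fun i j β => hinit.weight_law _ i j β) (fun j => hinit.bias_law _ j) ?_ x
  have hinj : Function.Injective (Sum.map (fun p : Fin c × Fin c × Ker k => (l + 1, p))
      (fun j : Fin c => (l + 1, j))) :=
    Function.Injective.sumMap (fun _ _ h => (Prod.mk.inj h).2) (fun _ _ h => (Prod.mk.inj h).2)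
  convert hinit.indep.precomp hinj using 1
  ext q ω
  rcases q with q | q <;> rfl

/-- Given the post-activations of layer `l`, the pre-activations of the next layer are i.i.d.
centered Gaussian vectors with covariance `layerCov`. -/
lemma IsGaussianInit.lintegral_preActVec (hinit : IsGaussianInit P v σw σb w b)
    (hv : ∀ β, 0 ≤ v β) (hv1 : ∑ β, v β = 1) {φ : ℝ → ℝ} (hφm : Measurable φ)
    (x0 : Fin c → ZMod n → ℝ) (l : ℕ)
    {f : (Fin c → ZMod n → ℝ) × (Fin c → EuclideanSpace ℝ (ZMod n)) → ℝ≥0∞} (hf : Measurable f) :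
    ∫⁻ ω, f (postActRV φ x0 w b l ω, preActVec φ x0 w b l ω) ∂P =
      ∫⁻ ω, ∫⁻ z, f (postActRV φ x0 w b l ω, z) ∂(Measure.pi fun _ : Fin c =>
        multivariateGaussian 0 (layerCov v σw σb (postActRV φ x0 w b l ω))) ∂P := by
  have hX := hinit.aemeasurable_postActRV hφm x0 l
  have hΘ := hinit.aemeasurable_layerParam l
  have hprod := (indepFun_iff_map_prod_eq_prod_map_map hX hΘ).1
    (hinit.indepFun_postActRV hφm x0 l)
  have : IsProbabilityMeasure (layerParamLaw P w b l) := Measure.isProbabilityMeasure_map hΘ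
  set F : (Fin c → ZMod n → ℝ) × (Fin c → Fin c → Ker k → ℝ) × (Fin c → ℝ) → ℝ≥0∞ :=
    fun p => f (p.1, fun j => WithLp.toLp 2 (convLayer p.1 p.2.1 p.2.2 j)) with hF
  have hFm : Measurable F := hf.comp (measurable_fst.prodMk measurable_convLayerVec)
  have h1 : ∫⁻ ω, f (postActRV φ x0 w b l ω, preActVec φ x0 w b l ω) ∂P =
      ∫⁻ p, F p ∂(P.map (postActRV φ x0 w b l)).prod (layerParamLaw P w b l) := by
    rw [layerParamLaw, ← hprod, lintegral_map' hFm.aemeasurable (hX.prodMk hΘ)]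
    rfl
  rw [h1, lintegral_prod _ hFm.aemeasurable, lintegral_map'
      (hFm.lintegral_prod_right').aemeasurable hX]
  refine lintegral_congr fun ω => ?_
  rw [← hinit.map_layerParamLaw hv hv1 l, lintegral_map]
  · exact hf.comp (by fun_prop)
  · exact measurable_convLayerVec.comp (f := fun θ => (postActRV φ x0 w b l ω, θ)) (by fun_prop)

lemma IsGaussianInit.integral_preActVec (hinit : IsGaussianInit P v σw σb w b)
    (hv : ∀ β, 0 ≤ v β) (hv1 : ∑ β, v β = 1) {φ : ℝ → ℝ} (hφm : Measurable φ)
    (x0 : Fin c → ZMod n → ℝ) (l : ℕ)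
    {f : (Fin c → EuclideanSpace ℝ (ZMod n)) → ℝ} (hf : Measurable f)
    (hfi : Integrable (fun ω => f (preActVec φ x0 w b l ω)) P) :
    ∫ ω, f (preActVec φ x0 w b l ω) ∂P =
      ∫ ω, ∫ z, f z ∂(Measure.pi fun _ : Fin c =>
        multivariateGaussian 0 (layerCov v σw σb (postActRV φ x0 w b l ω))) ∂P := by
  have hX := hinit.aemeasurable_postActRV hφm x0 l
  have hΘ := hinit.aemeasurable_layerParam l
  have hprod := (indepFun_iff_map_prod_eq_prod_map_map hX hΘ).1
    (hinit.indepFun_postActRV hφm x0 l)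
  have : IsProbabilityMeasure (layerParamLaw P w b l) := Measure.isProbabilityMeasure_map hΘ
  have : IsProbabilityMeasure (P.map (postActRV φ x0 w b l)) := Measure.isProbabilityMeasure_map hX
  set F : (Fin c → ZMod n → ℝ) × (Fin c → Fin c → Ker k → ℝ) × (Fin c → ℝ) → ℝ :=
    fun p => f (fun j => WithLp.toLp 2 (convLayer p.1 p.2.1 p.2.2 j)) with hF
  have hFm : Measurable F := hf.comp measurable_convLayerVec
  have h1 : ∫ ω, f (preActVec φ x0 w b l ω) ∂P =
      ∫ p, F p ∂(P.map (postActRV φ x0 w b l)).prod (layerParamLaw P w b l) := by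
    rw [layerParamLaw, ← hprod, integral_map (hX.prodMk hΘ) hFm.aestronglyMeasurable]
    rfl
  have h2 : Integrable F ((P.map (postActRV φ x0 w b l)).prod (layerParamLaw P w b l)) := by
    rw [layerParamLaw, ← hprod, integrable_map_measure hFm.aestronglyMeasurable (hX.prodMk hΘ)]
    exact hfi
  rw [h1, integral_prod _ h2, integral_map hX
    hFm.stronglyMeasurable.integral_prod_right'.aestronglyMeasurable]
  refine integral_congr_ae (.of_forall fun ω => ?_)
  simp only
  rw [← hinit.map_layerParamLaw hv hv1 l, integral_map]
  · exact (measurable_convLayerVec.comp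
      (f := fun θ => (postActRV φ x0 w b l ω, θ)) (by fun_prop)).aemeasurable
  · exact hf.aestronglyMeasurable

/-- If the pre-activations fall into `B` with conditional probability at most `δ` whenever the
previous layer lies in `A`, then they do so with probability at most `P(Aᶜ) + δ`. -/
lemma IsGaussianInit.measure_preActVec_le (hinit : IsGaussianInit P v σw σb w b)
    (hv : ∀ β, 0 ≤ v β) (hv1 : ∑ β, v β = 1) {φ : ℝ → ℝ} (hφm : Measurable φ)
    (x0 : Fin c → ZMod n → ℝ) (l : ℕ) {B : Set (Fin c → EuclideanSpace ℝ (ZMod n))}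
    (hB : MeasurableSet B) {A : Set (Matrix (ZMod n) (ZMod n) ℝ)} {δ : ℝ≥0∞}
    (hA : ∀ K ∈ A, Measure.pi (fun _ : Fin c => multivariateGaussian 0 K) B ≤ δ) :
    P {ω | preActVec φ x0 w b l ω ∈ B} ≤
      P {ω | layerCov v σw σb (postActRV φ x0 w b l ω) ∉ A} + δ := by
  have hH := hinit.aemeasurable_preActVec hφm x0 l
  have h := hinit.lintegral_preActVec hv hv1 hφm x0 l
    (f := fun p => B.indicator (1 : (Fin c → EuclideanSpace ℝ (ZMod n)) → ℝ≥0∞) p.2)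
    ((measurable_one.indicator hB).comp measurable_snd)
  have h1 : ∫⁻ ω, B.indicator (1 : (Fin c → EuclideanSpace ℝ (ZMod n)) → ℝ≥0∞)
      (preActVec φ x0 w b l ω) ∂P =
      P {ω | preActVec φ x0 w b l ω ∈ B} := by
    exact lintegral_indicator_one₀ (hH.nullMeasurableSet_preimage hB)
  simp only [lintegral_indicator_one hB] at h
  rw [← h1, h]
  set N := {ω | layerCov v σw σb (postActRV φ x0 w b l ω) ∉ A}
  calc _ ≤ ∫⁻ ω, (toMeasurable P N).indicator (1 : Ω → ℝ≥0∞) ω + δ ∂P := by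
        refine lintegral_mono fun ω => ?_
        by_cases hω : layerCov v σw σb (postActRV φ x0 w b l ω) ∈ A
        · exact (hA _ hω).trans le_add_self
        · have : ω ∈ toMeasurable P N := subset_toMeasurable P N hω
          simp only [Set.indicator_of_mem this, Pi.one_apply]
          exact prob_le_one.trans le_self_add
    _ = P N + δ := by
        rw [lintegral_add_right _ measurable_const,
          lintegral_indicator_one (measurableSet_toMeasurable P N), measure_toMeasurable]
        simp

end Disintegration

/-! ### Propagation of the covariances through the layers -/

/-- Convergence in probability along a filter: `X c` lies in every set of `F` with probability
tending to one. The probability spaces may depend on `c`. -/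
def TendstoInProb {Ω : ℕ → Type*} [∀ c, MeasurableSpace (Ω c)] (μ : ∀ c, Measure (Ω c))
    {E : Type*} (X : ∀ c, Ω c → E) (F : Filter E) : Prop :=
  ∀ V ∈ F, Tendsto (fun c => μ c {ω | X c ω ∉ V}) atTop (𝓝 0)

section TendstoInProb

variable {Ω : ℕ → Type*} [∀ c, MeasurableSpace (Ω c)] {μ : ∀ c, Measure (Ω c)}

lemma tendsto_measure_zero_of_subset_iUnion {ι : Type*} [Fintype ι] {A : ∀ c, Set (Ω c)}
    {B : ι → ∀ c, Set (Ω c)} (hAB : ∀ c, A c ⊆ ⋃ i, B i c)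
    (hB : ∀ i, Tendsto (fun c => μ c (B i c)) atTop (𝓝 0)) :
    Tendsto (fun c => μ c (A c)) atTop (𝓝 0) := by
  have h := tendsto_finsetSum Finset.univ fun i _ => hB i
  simp only [Finset.sum_const_zero] at h
  exact tendsto_of_tendsto_of_tendsto_of_le_of_le tendsto_const_nhds h (fun _ => zero_le)
    fun c => (measure_mono (hAB c)).trans (measure_iUnion_fintype_le _ _)

lemma tendsto_measure_zero_of_subset_union {A B C : ∀ c, Set (Ω c)} (hAB : ∀ c, A c ⊆ B c ∪ C c)
    (hB : Tendsto (fun c => μ c (B c)) atTop (𝓝 0))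
    (hC : Tendsto (fun c => μ c (C c)) atTop (𝓝 0)) :
    Tendsto (fun c => μ c (A c)) atTop (𝓝 0) := by
  have h := hB.add hC
  rw [add_zero] at h
  exact tendsto_of_tendsto_of_tendsto_of_le_of_le tendsto_const_nhds h (fun _ => zero_le)
    fun c => (measure_mono (hAB c)).trans (measure_union_le _ _)

lemma TendstoInProb.comp {E E' : Type*} {X : ∀ c, Ω c → E} {F : Filter E} {F' : Filter E'}
    (hX : TendstoInProb μ X F) {f : E → E'} (hf : Tendsto f F F') :
    TendstoInProb μ (fun c ω => f (X c ω)) F' :=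
  fun _ hV => hX _ (hf hV)

lemma tendstoInProb_matrix {ι : Type*} [Fintype ι] {X : ∀ c, Ω c → Matrix ι ι ℝ} {M : Matrix ι ι ℝ}
    (h : ∀ α α', ∀ ε > 0, Tendsto (fun c => μ c {ω | ε ≤ |X c ω α α' - M α α'|}) atTop (𝓝 0)) :
    TendstoInProb μ X (𝓝 M) := by
  intro V hV
  obtain ⟨ε, hε, hball⟩ :=
    (Metric.mem_nhds_iff (α := ι → ι → ℝ) (x := M) (s := V)).1 hV
  refine tendsto_measure_zero_of_subset_iUnion (ι := ι × ι)
    (B := fun p c => {ω | ε ≤ |X c ω p.1 p.2 - M p.1 p.2|}) (fun c ω hω => ?_) fun p => h _ _ ε hε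
  by_contra hcon
  simp only [Set.mem_iUnion, Set.mem_ofPred_eq, not_exists, not_le] at hcon
  exact hω (hball ((dist_pi_lt_iff hε).2 fun α => (dist_pi_lt_iff hε).2 fun α' => hcon (α, α')))

lemma tendstoInProb_const {E : Type*} {x : ℕ → E} {F : Filter E} (hx : Tendsto x atTop F) :
    TendstoInProb μ (fun c _ => x c) F := by
  intro V hV
  refine tendsto_const_nhds.congr' ?_
  filter_upwards [hx hV] with c hc
  have : x c ∈ V := hc
  simp [this]

end TendstoInProb

section GaussMoment

variable {n k : ℕ} [NeZero n] {φ : ℝ → ℝ}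

lemma posSemidef_gaussMoment (hφm : Measurable φ)
    (hφ : ∀ s : ℝ≥0, MemLp φ 2 (gaussianReal 0 s)) {S : Matrix (ZMod n) (ZMod n) ℝ}
    (hS : S.PosSemidef) : (gaussMoment φ S).PosSemidef := by
  have hi (α α' : ZMod n) : Integrable (fun z : EuclideanSpace ℝ (ZMod n) => φ (z α) * φ (z α'))
      (multivariateGaussian 0 S) :=
    (memLp_eval_multivariateGaussian hφm hφ hS α).integrable_mul
      (memLp_eval_multivariateGaussian hφm hφ hS α')
  refine .of_dotProduct_mulVec_nonneg ?_ fun t => ?_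
  · ext α α'
    simp [gaussMoment, mul_comm]
  · have : star t ⬝ᵥ (gaussMoment φ S).mulVec t =
        ∫ z, (∑ α, t α * φ (z α)) ^ 2 ∂(multivariateGaussian 0 S) := by
      have hsq (z : EuclideanSpace ℝ (ZMod n)) : (∑ α, t α * φ (z α)) ^ 2 =
          ∑ α, ∑ α', t α * t α' * (φ (z α) * φ (z α')) := by
        rw [sq, Finset.sum_mul_sum]
        refine Finset.sum_congr rfl fun α _ => Finset.sum_congr rfl fun α' _ => ?_
        ring
      simp only [hsq]
      rw [integral_finsetSum _ fun α _ => integrable_finsetSum _ fun α' _ => (hi α α').const_mul _]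
      simp only [dotProduct, Matrix.mulVec, gaussMoment, Matrix.of_apply, Finset.mul_sum,
        star_trivial]
      refine Finset.sum_congr rfl fun α _ => ?_
      rw [integral_finsetSum _ fun α' _ => (hi α α').const_mul _]
      refine Finset.sum_congr rfl fun α' _ => ?_
      rw [integral_const_mul]
      ring
    rw [this]
    exact integral_nonneg fun z => sq_nonneg _

lemma posSemidef_of_tendsto {ι : Type*} [Fintype ι] {M : ℕ → Matrix ι ι ℝ} {G : Matrix ι ι ℝ}
    (hM : ∀ c, (M c).PosSemidef) (h : Tendsto M atTop (𝓝 G)) : G.PosSemidef := by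
  refine .of_dotProduct_mulVec_nonneg ?_ fun t => ?_
  · have h1 : Continuous fun K : Matrix ι ι ℝ => K.conjTranspose := by fun_prop
    refine tendsto_nhds_unique ((h1.tendsto G).comp h) ?_
    refine h.congr fun c => ((hM c).1).symm
  · have h1 : Continuous fun K : Matrix ι ι ℝ => star t ⬝ᵥ K.mulVec t := by fun_prop
    exact ge_of_tendsto' ((h1.tendsto G).comp h) fun c => (hM c).dotProduct_mulVec_nonneg t

/-- If the second moment of `φ(h_α)` vanishes in the limit, then `φ` vanishes almost everywhere for
the `α`-marginal of `N(0, K)`, for all admissible `K` near `S`. -/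
lemma eventually_ae_eq_zero_of_gaussMoment_eq_zero (hφm : Measurable φ)
    (hφ : ∀ s : ℝ≥0, MemLp φ 2 (gaussianReal 0 s)) {S : Matrix (ZMod n) (ZMod n) ℝ}
    (hS : S.PosSemidef) {α : ZMod n} (hc : ¬ ContinuousAt φ 0) (h0 : gaussMoment φ S α α = 0) :
    ∀ᶠ K in 𝓝[admissibleCov φ S] S, ∀ᵐ z ∂(multivariateGaussian 0 K), φ (z α) = 0 := by
  have hev {K : Matrix (ZMod n) (ZMod n) ℝ} (hK : K.PosSemidef) :=
    measurePreserving_eval_multivariateGaussian (μ := 0) hK (i := α)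
  have hms : MeasurableSet {x | φ x = 0} := hφm (measurableSet_singleton 0)
  have hae {K : Matrix (ZMod n) (ZMod n) ℝ} (hK : K.PosSemidef) :
      (∀ᵐ z ∂(multivariateGaussian 0 K), φ (z α) = 0) ↔
        ∀ᵐ x ∂(gaussianReal 0 (K α α).toNNReal), φ x = 0 := by
    have := (hev hK).map_eq
    simp only [PiLp.zero_apply] at this
    rw [← this, ae_map_iff (hev hK).measurable.aemeasurable hms]
  have hS0 : ∀ᵐ x ∂(gaussianReal 0 (S α α).toNNReal), φ x = 0 := by
    rw [← hae hS]
    have hL := memLp_eval_multivariateGaussian hφm hφ hS α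
    have h0' : ∫ z, φ (z α) * φ (z α) ∂(multivariateGaussian 0 S) = 0 := h0
    rw [integral_eq_zero_iff_of_nonneg (fun z => mul_self_nonneg _) (hL.integrable_mul hL)] at h0'
    filter_upwards [h0'] with z hz
    simpa using hz
  rcases (hS.diag_nonneg (i := α)).lt_or_eq with hpos | hzero
  · have hnear : ∀ᶠ K : Matrix (ZMod n) (ZMod n) ℝ in 𝓝[admissibleCov φ S] S, 0 < K α α := by
      have h1 : Continuous fun K : Matrix (ZMod n) (ZMod n) ℝ => K α α := by fun_prop
      exact ((h1.tendsto S).eventually (lt_mem_nhds hpos)).filter_mono nhdsWithin_le_nhds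
    filter_upwards [hnear, self_mem_nhdsWithin] with K hK hK'
    rw [hae hK'.1]
    have e1 := gaussianReal_absolutelyContinuous' 0 (v := (S α α).toNNReal)
      (Real.toNNReal_pos.2 hpos).ne'
    have e2 := gaussianReal_absolutelyContinuous 0 (v := (K α α).toNNReal)
      (Real.toNNReal_pos.2 hK).ne'
    exact (e2.trans e1).ae_le hS0
  · filter_upwards [self_mem_nhdsWithin] with K hK
    rw [hae hK.1]
    have : K α α = S α α := by
      rcases hK.2 α with h | h | h
      · exact absurd h hc
      · exact absurd hzero h.ne
      · rw [h]; exact hzero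
    rwa [this]

end GaussMoment

lemma channelGram_postActRV_succ {n k c : ℕ} {Ω : Type*} (φ : ℝ → ℝ) (x0 : Fin c → ZMod n → ℝ)
    (w : ℕ → Fin c → Fin c → Ker k → Ω → ℝ) (b : ℕ → Fin c → Ω → ℝ) (l : ℕ) (ω : Ω)
    (α α' : ZMod n) :
    channelGram (postActRV φ x0 w b (l + 1) ω) α α' =
      (c : ℝ)⁻¹ * ∑ i, φ (preActVec φ x0 w b l ω i α) * φ (preActVec φ x0 w b l ω i α') := rfl

lemma layerCov_apply_self {n k c : ℕ} (v : Ker k → ℝ) (σw σb : ℝ) (x : Fin c → ZMod n → ℝ)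
    (α : ZMod n) :
    layerCov v σw σb x α α = ∑ β : Ker k, v β *
      (σw ^ 2 * channelGram x (α + ((β : ℤ) : ZMod n)) (α + ((β : ℤ) : ZMod n)) + σb ^ 2) := rfl

section Propagation

variable {n k : ℕ} [NeZero n] {φ : ℝ → ℝ} {σw σb : ℝ} {v : Ker k → ℝ}
  {x0 : ∀ c : ℕ, Fin c → ZMod n → ℝ} {Ω : ℕ → Type*} [∀ c, MeasurableSpace (Ω c)]
  {μ : ∀ c, Measure (Ω c)} [∀ c, IsProbabilityMeasure (μ c)]
  {w : ∀ c : ℕ, ℕ → Fin c → Fin c → Ker k → Ω c → ℝ} {b : ∀ c : ℕ, ℕ → Fin c → Ω c → ℝ}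

/-- An event about the pre-activations has probability tending to zero if its conditional
probability does, uniformly over the likely values of the conditional covariance. -/
lemma tendsto_measure_preActVec_zero (hinit : ∀ c, IsGaussianInit (μ c) v σw σb (w c) (b c))
    (hv : ∀ β, 0 ≤ v β) (hv1 : ∑ β, v β = 1) (hφm : Measurable φ) {l : ℕ}
    {F : Filter (Matrix (ZMod n) (ZMod n) ℝ)}
    (hK : TendstoInProb μ
      (fun c ω => layerCov v σw σb (postActRV φ (x0 c) (w c) (b c) l ω)) F)
    {B : ∀ c : ℕ, Set (Fin c → EuclideanSpace ℝ (ZMod n))} (hB : ∀ c, MeasurableSet (B c))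
    (h : ∀ δ : ℝ≥0∞, δ ≠ 0 → ∀ᶠ p : ℕ × Matrix (ZMod n) (ZMod n) ℝ in atTop ×ˢ F,
      Measure.pi (fun _ : Fin p.1 => multivariateGaussian 0 p.2) (B p.1) ≤ δ) :
    Tendsto (fun c => μ c {ω | preActVec φ (x0 c) (w c) (b c) l ω ∈ B c}) atTop (𝓝 0) := by
  rw [ENNReal.tendsto_nhds_zero]
  intro δ hδ
  have hδ2 := (ENNReal.half_pos hδ.ne')
  obtain ⟨pa, ha, pb, hb, hab⟩ := eventually_prod_iff.1 (h (δ / 2) hδ2.ne')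
  filter_upwards [ha, ENNReal.tendsto_nhds_zero.1 (hK {K | pb K} hb) _ hδ2] with c hc1 hc2
  refine ((hinit c).measure_preActVec_le hv hv1 hφm (x0 c) l (hB c) (A := {K | pb K})
    (δ := δ / 2) fun K hK => hab hc1 hK).trans ?_
  exact (add_le_add hc2 le_rfl).trans (ENNReal.add_halves δ).le

/-- One step of the law of large numbers: the empirical second moments of the next layer
concentrate. -/
lemma tendstoInProb_channelGram_succ
    (hinit : ∀ c, IsGaussianInit (μ c) v σw σb (w c) (b c))
    (hv : ∀ β, 0 ≤ v β) (hv1 : ∑ β, v β = 1) (hφm : Measurable φ)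
    (hφ : ∀ s : ℝ≥0, MemLp φ 2 (gaussianReal 0 s)) {l : ℕ} {S : Matrix (ZMod n) (ZMod n) ℝ}
    (hS : S.PosSemidef)
    (hK : TendstoInProb μ (fun c ω => layerCov v σw σb (postActRV φ (x0 c) (w c) (b c) l ω))
      (𝓝[admissibleCov φ S] S)) :
    TendstoInProb μ (fun c ω => channelGram (postActRV φ (x0 c) (w c) (b c) (l + 1) ω))
      (𝓝 (gaussMoment φ S)) := by
  refine tendstoInProb_matrix fun α α' ε hε => ?_
  refine tendsto_measure_preActVec_zero hinit hv hv1 hφm hK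
    (B := fun c => {h | ε ≤ |(c : ℝ)⁻¹ * ∑ i, φ (h i α) * φ (h i α') - gaussMoment φ S α α'|})
    (fun c => measurableSet_le measurable_const (by fun_prop)) fun δ hδ => ?_
  exact eventually_measure_pi_avg_le hφm hφ hS α α' hε hδ

/-- If `φ` is discontinuous at `0` and the second moment of `φ(h_α)` vanishes in the limit, then
`φ(h_α)` is exactly zero in all channels with probability tending to one. -/
lemma tendsto_measure_exists_ne_zero
    (hinit : ∀ c, IsGaussianInit (μ c) v σw σb (w c) (b c))
    (hv : ∀ β, 0 ≤ v β) (hv1 : ∑ β, v β = 1) (hφm : Measurable φ)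
    (hφ : ∀ s : ℝ≥0, MemLp φ 2 (gaussianReal 0 s)) {l : ℕ} {S : Matrix (ZMod n) (ZMod n) ℝ}
    (hS : S.PosSemidef)
    (hK : TendstoInProb μ (fun c ω => layerCov v σw σb (postActRV φ (x0 c) (w c) (b c) l ω))
      (𝓝[admissibleCov φ S] S)) {α : ZMod n} (hc : ¬ ContinuousAt φ 0)
    (h0 : gaussMoment φ S α α = 0) :
    Tendsto (fun c => μ c {ω | ∃ i, φ (preActVec φ (x0 c) (w c) (b c) l ω i α) ≠ 0})
      atTop (𝓝 0) := by
  refine tendsto_measure_preActVec_zero hinit hv hv1 hφm hK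
    (B := fun c => {h | ∃ i, φ (h i α) ≠ 0}) (fun c => ?_) fun δ hδ => ?_
  · have : {h : Fin c → EuclideanSpace ℝ (ZMod n) | ∃ i, φ (h i α) ≠ 0} =
        ⋃ i, {h | φ (h i α) ≠ 0} := by ext; simp
    rw [this]
    refine MeasurableSet.iUnion fun i => ?_
    exact (measurableSet_eq_fun (by fun_prop) measurable_const).compl
  · filter_upwards [(Eventually.prod_inr
      (eventually_ae_eq_zero_of_gaussMoment_eq_zero hφm hφ hS hc h0) atTop)] with p hp
    have hz : ∀ᵐ h ∂(Measure.pi fun _ : Fin p.1 => multivariateGaussian 0 p.2),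
        ∀ i, φ (h i α) = 0 := ae_all_iff.2 fun i =>
      (measurePreserving_eval (fun _ : Fin p.1 => multivariateGaussian 0 p.2)
        i).quasiMeasurePreserving.ae hp
    have : Measure.pi (fun _ : Fin p.1 => multivariateGaussian 0 p.2)
        {h | ∃ i, φ (h i α) ≠ 0} = 0 := by
      rw [ae_iff] at hz
      simpa using hz
    rw [this]
    exact zero_le

/-- A vanishing diagonal entry of `𝒜_v ⋆ 𝒞(S)` forces `σb = 0` and the vanishing of every second
moment that enters it with a nonzero coefficient. -/
lemma crossCorr_cMap_diag_nonpos {S : Matrix (ZMod n) (ZMod n) ℝ} (hv : ∀ β, 0 ≤ v β)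
    (hv1 : ∑ β, v β = 1) (hM : (gaussMoment φ S).PosSemidef) {α : ZMod n}
    (h : crossCorr v (cMap φ σw σb S) α α ≤ 0) :
    σb ^ 2 = 0 ∧ ∀ β : Ker k, v β * σw ^ 2 ≠ 0 →
      gaussMoment φ S (α + ((β : ℤ) : ZMod n)) (α + ((β : ℤ) : ZMod n)) = 0 := by
  set g : Ker k → ℝ :=
    fun β => gaussMoment φ S (α + ((β : ℤ) : ZMod n)) (α + ((β : ℤ) : ZMod n))
  have hg (β) : 0 ≤ g β := hM.diag_nonneg
  have hsum : crossCorr v (cMap φ σw σb S) α α = ∑ β, (v β * σw ^ 2 * g β) + σb ^ 2 := by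
    have h1 : crossCorr v (cMap φ σw σb S) α α = ∑ β, v β * (σw ^ 2 * g β + σb ^ 2) := rfl
    simp only [h1, mul_add, Finset.sum_add_distrib]
    rw [← Finset.sum_mul, hv1, one_mul]
    simp only [mul_assoc]
  have hterm (β) : 0 ≤ v β * σw ^ 2 * g β :=
    mul_nonneg (mul_nonneg (hv β) (sq_nonneg _)) (hg β)
  have hs : 0 ≤ ∑ β, (v β * σw ^ 2 * g β) := Finset.sum_nonneg fun β _ => hterm β
  rw [hsum] at h
  refine ⟨by nlinarith [sq_nonneg σb], fun β hβ => ?_⟩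
  have hs0 : ∑ β, (v β * σw ^ 2 * g β) = 0 := by nlinarith [sq_nonneg σb]
  have := (Finset.sum_eq_zero_iff_of_nonneg fun β _ => hterm β).1 hs0 β (Finset.mem_univ _)
  exact (mul_eq_zero.1 this).resolve_left hβ

/-- Convergence of the conditional covariances propagates from one layer to the next. -/
lemma tendstoInProb_layerCov_succ
    (hinit : ∀ c, IsGaussianInit (μ c) v σw σb (w c) (b c))
    (hv : ∀ β, 0 ≤ v β) (hv1 : ∑ β, v β = 1) (hφm : Measurable φ)
    (hφ : ∀ s : ℝ≥0, MemLp φ 2 (gaussianReal 0 s)) {l : ℕ} {S : Matrix (ZMod n) (ZMod n) ℝ}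
    (hS : S.PosSemidef)
    (hK : TendstoInProb μ (fun c ω => layerCov v σw σb (postActRV φ (x0 c) (w c) (b c) l ω))
      (𝓝[admissibleCov φ S] S)) :
    TendstoInProb μ (fun c ω => layerCov v σw σb (postActRV φ (x0 c) (w c) (b c) (l + 1) ω))
      (𝓝[admissibleCov φ (crossCorr v (cMap φ σw σb S))] (crossCorr v (cMap φ σw σb S))) := by
  have hgram := tendstoInProb_channelGram_succ hinit hv hv1 hφm hφ hS hK
  have hcont : Continuous fun M : Matrix (ZMod n) (ZMod n) ℝ => crossCorr v (affineCov σw σb M) :=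
    (continuous_crossCorr v).comp (continuous_affineCov σw σb)
  have hconv := hgram.comp (hcont.tendsto (gaussMoment φ S))
  set S' := crossCorr v (cMap φ σw σb S) with hS'
  have hM := posSemidef_gaussMoment hφm hφ hS
  intro V hV
  obtain ⟨U, hU, hUV⟩ := mem_nhdsWithin_iff_exists_mem_nhds_inter.1 hV
  refine tendsto_measure_zero_of_subset_union
    (B := fun c => {ω | layerCov v σw σb (postActRV φ (x0 c) (w c) (b c) (l + 1) ω) ∉ U})
    (C := fun c => {ω | layerCov v σw σb (postActRV φ (x0 c) (w c) (b c) (l + 1) ω) ∉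
      admissibleCov φ S'}) (fun c ω hω => ?_) (hconv U hU) ?_
  · by_contra hcon
    simp only [Set.mem_union, Set.mem_ofPred_eq, not_or, not_not] at hcon
    exact hω (hUV hcon)
  by_cases hc : ContinuousAt φ 0
  · refine tendsto_const_nhds.congr fun c => ?_
    have : {ω | layerCov v σw σb (postActRV φ (x0 c) (w c) (b c) (l + 1) ω) ∉
        admissibleCov φ S'} = ∅ := by
      ext ω
      simp only [Set.mem_ofPred_eq, Set.mem_empty_iff_false, iff_false, not_not]
      exact ⟨posSemidef_layerCov hv _ _ _, fun α => Or.inl hc⟩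
    rw [this, measure_empty]
  refine tendsto_measure_zero_of_subset_iUnion (ι := ZMod n × Ker k)
    (B := fun p c => {ω | S' p.1 p.1 ≤ 0 ∧ v p.2 * σw ^ 2 ≠ 0 ∧
      ∃ i, φ (preActVec φ (x0 c) (w c) (b c) l ω i (p.1 + ((p.2 : ℤ) : ZMod n))) ≠ 0})
    (fun c ω hω => ?_) fun p => ?_
  · by_contra hcon
    simp only [Set.mem_iUnion, Set.mem_ofPred_eq, not_exists, not_and, ne_eq, not_not] at hcon
    refine hω ⟨posSemidef_layerCov hv _ _ _, fun α => Or.inr ?_⟩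
    rcases lt_or_ge 0 (S' α α) with h | h
    · exact Or.inl h
    right
    have hσb := (crossCorr_cMap_diag_nonpos hv hv1 hM h).1
    rw [layerCov_apply_self]
    refine Finset.sum_eq_zero fun β _ => ?_
    by_cases hvβ : v β * σw ^ 2 = 0
    · rw [mul_add, ← mul_assoc, hvβ, hσb]; simp
    · have hz := hcon (α, β) h hvβ
      rw [channelGram_postActRV_succ, hσb]
      simp [hz]
  · by_cases hp : S' p.1 p.1 ≤ 0 ∧ v p.2 * σw ^ 2 ≠ 0
    · have := tendsto_measure_exists_ne_zero hinit hv hv1 hφm hφ hS hK hc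
        ((crossCorr_cMap_diag_nonpos hv hv1 hM hp.1).2 p.2 hp.2)
      simpa only [hp.1, hp.2, true_and, ne_eq, not_false_eq_true] using this
    · have : ∀ c, {ω : Ω c | S' p.1 p.1 ≤ 0 ∧ v p.2 * σw ^ 2 ≠ 0 ∧
          ∃ i, φ (preActVec φ (x0 c) (w c) (b c) l ω i (p.1 + ((p.2 : ℤ) : ZMod n))) ≠ 0} = ∅ := by
        intro c
        ext ω
        simp only [Set.mem_ofPred_eq, Set.mem_empty_iff_false, iff_false]
        exact fun h => hp ⟨h.1, h.2.1⟩
      simp only [this, measure_empty]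
      exact tendsto_const_nhds

end Propagation

/-! ### Convergence in distribution -/

section WeakConvergence

variable {n k : ℕ} [NeZero n] {φ : ℝ → ℝ} {σw σb : ℝ} {v : Ker k → ℝ}
  {x0 : ∀ c : ℕ, Fin c → ZMod n → ℝ} {Ω : ℕ → Type*} [∀ c, MeasurableSpace (Ω c)]
  {μ : ∀ c, Measure (Ω c)} [∀ c, IsProbabilityMeasure (μ c)]
  {w : ∀ c : ℕ, ℕ → Fin c → Fin c → Ker k → Ω c → ℝ} {b : ∀ c : ℕ, ℕ → Fin c → Ω c → ℝ}

lemma map_pi_castAdd {E : Type*} [MeasurableSpace E] (N : Measure E) [IsProbabilityMeasure N]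
    (m d : ℕ) :
    (Measure.pi fun _ : Fin (m + d) => N).map (fun z (j : Fin m) => z (Fin.castAdd d j)) =
      Measure.pi fun _ : Fin m => N := by
  have h1 : iIndepFun (fun (j : Fin (m + d)) (z : Fin (m + d) → E) => z j)
      (Measure.pi fun _ : Fin (m + d) => N) :=
    iIndepFun_pi (X := fun _ => id) fun _ => aemeasurable_id
  have h2 := h1.precomp (Fin.castAdd_injective m d)
  rw [iIndepFun_iff_map_fun_eq_pi_map fun j => (measurable_pi_apply _).aemeasurable] at h2
  rw [h2]
  congr 1
  funext j
  exact (measurePreserving_eval (fun _ : Fin (m + d) => N) _).map_eq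

/-- If the conditional covariances converge in probability to `S`, the first `m` channels converge
in distribution to independent `N(0, S)` vectors. -/
lemma tendstoInDistribution_preActVec (hinit : ∀ c, IsGaussianInit (μ c) v σw σb (w c) (b c))
    (hv : ∀ β, 0 ≤ v β) (hv1 : ∑ β, v β = 1) (hφm : Measurable φ) {l : ℕ}
    {S : Matrix (ZMod n) (ZMod n) ℝ} (hS : S.PosSemidef)
    (hK : TendstoInProb μ (fun c ω => layerCov v σw σb (postActRV φ (x0 c) (w c) (b c) l ω))
      (𝓝[{K | K.PosSemidef}] S)) (m : ℕ) :
    TendstoInDistribution (fun (d : ℕ) (ω : Ω (m + d)) (j : Fin m) =>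
        preActVec φ (x0 (m + d)) (w (m + d)) (b (m + d)) l ω (Fin.castAdd d j))
      atTop id (fun d => μ (m + d)) (Measure.pi fun _ : Fin m => multivariateGaussian 0 S) := by
  have hrestr (d : ℕ) : Measurable fun (z : Fin (m + d) → EuclideanSpace ℝ (ZMod n)) (j : Fin m) =>
      z (Fin.castAdd d j) := by fun_prop
  have hmeas (d : ℕ) : AEMeasurable (fun (ω : Ω (m + d)) (j : Fin m) =>
      preActVec φ (x0 (m + d)) (w (m + d)) (b (m + d)) l ω (Fin.castAdd d j)) (μ (m + d)) :=
    (hrestr d).comp_aemeasurable ((hinit (m + d)).aemeasurable_preActVec hφm (x0 (m + d)) l)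
  refine ⟨hmeas, aemeasurable_id, ?_⟩
  refine ProbabilityMeasure.tendsto_iff_forall_integral_tendsto.2 fun f => ?_
  simp only [ProbabilityMeasure.coe_mk, Measure.map_id]
  -- the conditional expectation of `f` is a continuous function of the conditional covariance
  set F : Matrix (ZMod n) (ZMod n) ℝ → ℝ :=
    fun K => ∫ z, f z ∂(Measure.pi fun _ : Fin m => multivariateGaussian 0 K) with hF
  have hFcont : Tendsto F (𝓝[{K | K.PosSemidef}] S) (𝓝 (F S)) := by
    have h1 : Tendsto (fun K => ProbabilityMeasure.pi fun _ : Fin m => centeredGaussian K)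
        (𝓝[{K | K.PosSemidef}] S) (𝓝 (ProbabilityMeasure.pi fun _ : Fin m => centeredGaussian S)) :=
      (ProbabilityMeasure.continuous_pi.tendsto _).comp
        (tendsto_pi_nhds.2 fun _ => tendsto_multivariateGaussian hS)
    exact ProbabilityMeasure.tendsto_iff_forall_integral_tendsto.1 h1 f
  have hFbound (K) : |F K| ≤ ‖f‖ := by
    rw [← Real.norm_eq_abs]
    refine (norm_integral_le_of_norm_le_const (.of_forall fun z => f.norm_coe_le_norm z)).trans ?_
    simp
  have hexp (d : ℕ) : ∫ z, f z ∂((μ (m + d)).map fun (ω : Ω (m + d)) (j : Fin m) =>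
        preActVec φ (x0 (m + d)) (w (m + d)) (b (m + d)) l ω (Fin.castAdd d j)) - F S =
      ∫ ω, (F (layerCov v σw σb
        (postActRV φ (x0 (m + d)) (w (m + d)) (b (m + d)) l ω)) - F S) ∂(μ (m + d)) := by
    have hfm := f.continuous.measurable
    have hH := (hinit (m + d)).aemeasurable_preActVec hφm (x0 (m + d)) l
    have hcomp := (hfm.comp (hrestr d)).sub_const (F S)
    have hint : Integrable (fun ω => f fun j => preActVec φ (x0 (m + d)) (w (m + d))
        (b (m + d)) l ω (Fin.castAdd d j)) (μ (m + d)) :=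
      Integrable.of_bound ((hfm.comp_aemeasurable (hmeas d)).aestronglyMeasurable) ‖f‖
        (.of_forall fun ω => f.norm_coe_le_norm _)
    have h1 := (hinit (m + d)).integral_preActVec hv hv1 hφm (x0 (m + d)) l
      (f := fun z => f (fun j => z (Fin.castAdd d j)) - F S) hcomp
      (hint.sub (integrable_const _))
    rw [integral_map (hmeas d) hfm.aestronglyMeasurable]
    rw [integral_sub hint (integrable_const _), integral_const] at h1
    simp only [probReal_univ, one_smul] at h1
    rw [h1]
    refine integral_congr_ae (.of_forall fun ω => ?_)
    set K := layerCov v σw σb (postActRV φ (x0 (m + d)) (w (m + d)) (b (m + d)) l ω)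
    have hi : Integrable (fun z : Fin (m + d) → EuclideanSpace ℝ (ZMod n) =>
        f fun j => z (Fin.castAdd d j))
        (Measure.pi fun _ : Fin (m + d) => multivariateGaussian 0 K) :=
      Integrable.of_bound (hfm.comp (hrestr d)).aestronglyMeasurable ‖f‖
        (.of_forall fun z => f.norm_coe_le_norm _)
    simp only
    rw [integral_sub hi (integrable_const _), hF]
    simp only [integral_const, probReal_univ, one_smul]
    rw [← map_pi_castAdd (multivariateGaussian 0 K) m d,
      integral_map (hrestr d).aemeasurable hfm.aestronglyMeasurable]
  rw [Metric.tendsto_nhds]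
  intro ε hε
  set V : Set (Matrix (ZMod n) (ZMod n) ℝ) := {K | |F K - F S| < ε / 2}
  have hV : V ∈ 𝓝[{K | K.PosSemidef}] S := by
    have := (Metric.tendsto_nhds.1 hFcont) (ε / 2) (half_pos hε)
    simp only [Real.dist_eq] at this
    exact this
  have hP : Tendsto (fun d => μ (m + d) {ω | layerCov v σw σb
      (postActRV φ (x0 (m + d)) (w (m + d)) (b (m + d)) l ω) ∉ V}) atTop (𝓝 0) := by
    have := (hK V hV).comp (tendsto_add_atTop_nat m)
    simpa [Function.comp_def, add_comm] using this.congr fun d => by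
      simp only [Function.comp_apply]; rw [add_comm d m]
  have hP' := (ENNReal.tendsto_toReal ENNReal.zero_ne_top).comp hP
  have hP'' := hP'.const_mul (2 * ‖f‖)
  simp only [ENNReal.toReal_zero, mul_zero] at hP''
  filter_upwards [hP''.eventually (gt_mem_nhds (half_pos hε))] with d hd
  rw [Real.dist_eq]
  have hFS : ∫ z, f z ∂(Measure.pi fun _ : Fin m => multivariateGaussian 0 S) = F S := rfl
  rw [hFS, hexp d, ← Real.norm_eq_abs]
  set N := {ω | layerCov v σw σb (postActRV φ (x0 (m + d)) (w (m + d)) (b (m + d)) l ω) ∉ V}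
  have hmN := measurableSet_toMeasurable (μ (m + d)) N
  have hbound : ∀ ω, ‖F (layerCov v σw σb (postActRV φ (x0 (m + d)) (w (m + d))
      (b (m + d)) l ω)) - F S‖ ≤
        ε / 2 + (toMeasurable (μ (m + d)) N).indicator (fun _ => 2 * ‖f‖) ω := by
    intro ω
    rw [Real.norm_eq_abs]
    by_cases hω : ω ∈ N
    · rw [Set.indicator_of_mem (subset_toMeasurable _ _ hω)]
      have := abs_sub (F (layerCov v σw σb (postActRV φ (x0 (m + d)) (w (m + d))
        (b (m + d)) l ω))) (F S)
      linarith [hFbound S, hFbound (layerCov v σw σb (postActRV φ (x0 (m + d)) (w (m + d))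
        (b (m + d)) l ω))]
    · have h1 : |F (layerCov v σw σb (postActRV φ (x0 (m + d)) (w (m + d))
          (b (m + d)) l ω)) - F S| < ε / 2 := by
        by_contra hcon
        exact hω hcon
      have h2 : 0 ≤ (toMeasurable (μ (m + d)) N).indicator (fun _ => 2 * ‖f‖) ω :=
        Set.indicator_nonneg (fun _ _ => by positivity) _
      linarith
  refine lt_of_le_of_lt (norm_integral_le_of_norm_le
    ((integrable_const (ε / 2)).add ((integrable_const (2 * ‖f‖)).indicator hmN))
    (.of_forall hbound)) ?_
  rw [integral_add' (integrable_const _) ((integrable_const (2 * ‖f‖)).indicator hmN),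
    integral_indicator_const _ hmN]
  simp only [integral_const, measureReal_def, measure_univ, ENNReal.toReal_one, smul_eq_mul,
    measure_toMeasurable]
  simp only [Function.comp_apply] at hd
  rw [mul_comm] at hd
  linarith

end WeakConvergence

/-! ### Moments of the pre-activations -/

section Moments

/-- The even moments of a centered Gaussian scale like powers of the variance. -/
lemma lintegral_pow_gaussianReal (s : ℝ≥0) (r : ℕ) :
    ∫⁻ x, ENNReal.ofReal (x ^ (2 * r)) ∂(gaussianReal 0 s) =
      ENNReal.ofReal ((s : ℝ) ^ r) * ∫⁻ x, ENNReal.ofReal (x ^ (2 * r)) ∂(gaussianReal 0 1) := by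
  have h := gaussianReal_map_const_mul (μ := 0) (v := 1) (√(s : ℝ))
  have hs : (NNReal.mk (√(s : ℝ) ^ 2) (sq_nonneg _) * 1 : ℝ≥0) = s := by
    rw [mul_one]
    ext
    exact Real.sq_sqrt s.coe_nonneg
  rw [hs, mul_zero] at h
  rw [← h, lintegral_map (by fun_prop) (by fun_prop), ← lintegral_const_mul _ (by fun_prop)]
  refine lintegral_congr fun x => ?_
  rw [← ENNReal.ofReal_mul (by positivity), mul_pow, pow_mul √(s : ℝ), Real.sq_sqrt s.coe_nonneg]

lemma lintegral_pow_gaussianReal_ne_top (r : ℕ) :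
    ∫⁻ x, ENNReal.ofReal (x ^ (2 * r)) ∂(gaussianReal 0 1) ≠ ∞ := by
  have h : MemLp id ((2 * r : ℕ) : ℝ≥0∞) (gaussianReal 0 1) := by
    have := memLp_id_gaussianReal (μ := 0) (v := 1) ((2 * r : ℕ) : ℝ≥0)
    simpa using this
  have h2 := h.integrable_norm_pow'
  have h3 := h2.lintegral_lt_top
  refine ne_of_lt (lt_of_eq_of_lt (lintegral_congr fun x => ?_) h3)
  simp only [id, Real.norm_eq_abs]
  rw [pow_mul, pow_mul, sq_abs]

lemma abs_apply_le_of_posSemidef {ι : Type*} [Fintype ι] [DecidableEq ι] {K : Matrix ι ι ℝ}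
    (hK : K.PosSemidef) (i j : ι) : |K i j| ≤ (K i i + K j j) / 2 := by
  have hsymm : K j i = K i j := by simpa using hK.1.apply i j
  have h1 := hK.dotProduct_mulVec_nonneg (Pi.single i 1 + Pi.single j 1)
  have h2 := hK.dotProduct_mulVec_nonneg (Pi.single i 1 - Pi.single j 1)
  simp only [star_trivial, Matrix.mulVec_add, Matrix.mulVec_sub, add_dotProduct, sub_dotProduct,
    dotProduct_add, dotProduct_sub, Matrix.mulVec_single_one, single_one_dotProduct,
    Matrix.col_apply] at h1 h2
  rw [abs_le]
  constructor <;> linarith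

lemma exists_pow_affine_le {φ : ℝ → ℝ} {C : ℝ} {p : ℕ} (hC : ∀ x, |φ x| ≤ C * (1 + |x|) ^ p)
    (σw σb : ℝ)
    (q : ℕ) : ∃ A : ℝ, 0 ≤ A ∧ ∀ x,
      (σw ^ 2 * (φ x * φ x) + σb ^ 2) ^ q ≤ A * (1 + x ^ (2 * (p * q))) := by
  set D : ℝ := σw ^ 2 * C ^ 2 + σb ^ 2
  have hD : 0 ≤ D := by positivity
  refine ⟨D ^ q * 2 ^ (2 * (p * q) - 1), by positivity, fun x => ?_⟩
  have h1 : (1 : ℝ) ≤ (1 + |x|) ^ (2 * p) := one_le_pow₀ (by linarith [abs_nonneg x])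
  have h2 : φ x * φ x ≤ C ^ 2 * (1 + |x|) ^ (2 * p) := by
    have := mul_self_le_mul_self (abs_nonneg _) (hC x)
    rw [abs_mul_abs_self] at this
    refine this.trans (le_of_eq ?_)
    ring
  calc (σw ^ 2 * (φ x * φ x) + σb ^ 2) ^ q ≤ (D * (1 + |x|) ^ (2 * p)) ^ q := by
        refine pow_le_pow_left₀ (add_nonneg (mul_nonneg (sq_nonneg _) (mul_self_nonneg _))
          (sq_nonneg _)) ?_ q
        have := mul_le_mul_of_nonneg_left h2 (sq_nonneg σw)
        have := mul_le_mul_of_nonneg_left h1 (sq_nonneg σb)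
        simp only [D]
        linarith
    _ = D ^ q * (1 + |x|) ^ (2 * (p * q)) := by
        rw [mul_pow, ← pow_mul, mul_assoc]
    _ ≤ D ^ q * (2 ^ (2 * (p * q) - 1) * (1 ^ (2 * (p * q)) + |x| ^ (2 * (p * q)))) := by
        gcongr
        exact add_pow_le zero_le_one (abs_nonneg x) _
    _ = _ := by
        rw [one_pow, pow_mul |x|, sq_abs, ← pow_mul]
        ring

/-- Moment bound for one step: the diagonal of the next conditional covariance is an average of
squares, so Jensen's inequality bounds its powers by moments of single channels. -/
lemma layerCov_pow_le {n k c : ℕ} {φ : ℝ → ℝ} {σw σb : ℝ} {v : Ker k → ℝ}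
    {x0 : Fin c → ZMod n → ℝ} {Ω : Type*} {w : ℕ → Fin c → Fin c → Ker k → Ω → ℝ}
    {b : ℕ → Fin c → Ω → ℝ} (hv : ∀ β, 0 ≤ v β) (hv1 : ∑ β, v β = 1) (hc : 0 < c) {q r : ℕ} {A : ℝ}
    (hA : ∀ x, (σw ^ 2 * (φ x * φ x) + σb ^ 2) ^ q ≤ A * (1 + x ^ (2 * r))) (l : ℕ) (ω : Ω)
    (α : ZMod n) :
    layerCov v σw σb (postActRV φ x0 w b (l + 1) ω) α α ^ q ≤
      ∑ β : Ker k, v β * ∑ i, (c : ℝ)⁻¹ *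
        (A * (1 + preActVec φ x0 w b l ω i (α + ((β : ℤ) : ZMod n)) ^ (2 * r))) := by
  have hc' : (0 : ℝ) < c := by exact_mod_cast hc
  have hsum : ∑ _i : Fin c, (c : ℝ)⁻¹ = 1 := by
    simp [hc'.ne']
  have hy (γ : ZMod n) : σw ^ 2 * channelGram (postActRV φ x0 w b (l + 1) ω) γ γ + σb ^ 2 =
      ∑ i, (c : ℝ)⁻¹ * (σw ^ 2 * (φ (preActVec φ x0 w b l ω i γ) *
        φ (preActVec φ x0 w b l ω i γ)) + σb ^ 2) := by
    rw [channelGram_postActRV_succ]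
    simp only [mul_add, Finset.sum_add_distrib]
    rw [← Finset.sum_mul, hsum, one_mul]
    congr 1
    simp only [Finset.mul_sum]
    refine Finset.sum_congr rfl fun i _ => ?_
    ring
  have hnn (x : ℝ) : 0 ≤ σw ^ 2 * (φ x * φ x) + σb ^ 2 := by
    have := mul_self_nonneg (φ x)
    positivity
  have hynn (γ : ZMod n) :
      0 ≤ σw ^ 2 * channelGram (postActRV φ x0 w b (l + 1) ω) γ γ + σb ^ 2 := by
    rw [hy]
    exact Finset.sum_nonneg fun i _ => mul_nonneg (inv_nonneg.2 hc'.le) (hnn _)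
  rw [layerCov_apply_self]
  refine (Real.pow_arith_mean_le_arith_mean_pow Finset.univ v _ (fun β _ => hv β) hv1
    (fun β _ => hynn _) q).trans ?_
  refine Finset.sum_le_sum fun β _ => mul_le_mul_of_nonneg_left ?_ (hv β)
  rw [hy]
  refine (Real.pow_arith_mean_le_arith_mean_pow Finset.univ (fun _ : Fin c => (c : ℝ)⁻¹) _
    (fun i _ => inv_nonneg.2 hc'.le) hsum (fun i _ => hnn _) q).trans ?_
  exact Finset.sum_le_sum fun i _ => mul_le_mul_of_nonneg_left (hA _) (inv_nonneg.2 hc'.le)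

variable {n k c : ℕ} [NeZero n] {φ : ℝ → ℝ} {σw σb : ℝ} {v : Ker k → ℝ}
  {x0 : Fin c → ZMod n → ℝ} {Ω : Type*} [MeasurableSpace Ω]
  {P : Measure Ω} [IsProbabilityMeasure P]
  {w : ℕ → Fin c → Fin c → Ker k → Ω → ℝ} {b : ℕ → Fin c → Ω → ℝ}

lemma IsGaussianInit.lintegral_preActVec_pow (hinit : IsGaussianInit P v σw σb w b)
    (hv : ∀ β, 0 ≤ v β) (hv1 : ∑ β, v β = 1) (hφm : Measurable φ) (l r : ℕ) (j : Fin c)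
    (α : ZMod n) :
    ∫⁻ ω, ENNReal.ofReal ((preActVec φ x0 w b l ω j α) ^ (2 * r)) ∂P =
      (∫⁻ ω, ENNReal.ofReal (layerCov v σw σb (postActRV φ x0 w b l ω) α α ^ r) ∂P) *
        ∫⁻ x, ENNReal.ofReal (x ^ (2 * r)) ∂(gaussianReal 0 1) := by
  have hm : Measurable fun p : (Fin c → ZMod n → ℝ) × (Fin c → EuclideanSpace ℝ (ZMod n)) =>
      ENNReal.ofReal (p.2 j α ^ (2 * r)) := by fun_prop
  rw [hinit.lintegral_preActVec hv hv1 hφm x0 l hm,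
    ← lintegral_mul_const' _ _ (lintegral_pow_gaussianReal_ne_top r)]
  refine lintegral_congr fun ω => ?_
  set K := layerCov v σw σb (postActRV φ x0 w b l ω)
  have hK : K.PosSemidef := posSemidef_layerCov hv _ _ _
  have e1 := (measurePreserving_eval (fun _ : Fin c => multivariateGaussian 0 K) j).lintegral_comp
    (f := fun z => ENNReal.ofReal (z α ^ (2 * r))) (by fun_prop)
  have e2 := (measurePreserving_eval_multivariateGaussian (μ := 0) hK (i := α)).lintegral_comp
    (f := fun x => ENNReal.ofReal (x ^ (2 * r))) (by fun_prop)
  simp only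
  rw [e1, e2, PiLp.zero_apply, lintegral_pow_gaussianReal, Real.coe_toNNReal _ hK.diag_nonneg]

lemma IsGaussianInit.lintegral_layerCov_pow_succ_le (hinit : IsGaussianInit P v σw σb w b)
    (hv : ∀ β, 0 ≤ v β) (hv1 : ∑ β, v β = 1) (hφm : Measurable φ) (hc : 0 < c) {q r : ℕ}
    {A : ℝ} (hA0 : 0 ≤ A) (hA : ∀ x, (σw ^ 2 * (φ x * φ x) + σb ^ 2) ^ q ≤ A * (1 + x ^ (2 * r)))
    {l : ℕ} {B : ℝ≥0∞}
    (hB : ∀ α, ∫⁻ ω, ENNReal.ofReal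
      (layerCov v σw σb (postActRV φ x0 w b l ω) α α ^ r) ∂P ≤ B) (α : ZMod n) :
    ∫⁻ ω, ENNReal.ofReal (layerCov v σw σb (postActRV φ x0 w b (l + 1) ω) α α ^ q) ∂P ≤
      ENNReal.ofReal A * (1 + B * ∫⁻ x, ENNReal.ofReal (x ^ (2 * r)) ∂(gaussianReal 0 1)) := by
  have hc' : (0 : ℝ) < c := by exact_mod_cast hc
  have hH (i : Fin c) (γ : ZMod n) :
      AEMeasurable (fun ω => preActVec φ x0 w b l ω i γ) P :=
    (show Measurable fun z : Fin c → EuclideanSpace ℝ (ZMod n) => z i γ by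
      fun_prop).comp_aemeasurable (hinit.aemeasurable_preActVec hφm x0 l)
  have hnn (y : ℝ) : 0 ≤ y ^ (2 * r) := by
    rw [pow_mul]; positivity
  set D := ENNReal.ofReal A * (1 + B * ∫⁻ x, ENNReal.ofReal (x ^ (2 * r)) ∂(gaussianReal 0 1))
  have hterm (i : Fin c) (γ : ZMod n) :
      ∫⁻ ω, ENNReal.ofReal (A * (1 + preActVec φ x0 w b l ω i γ ^ (2 * r))) ∂P ≤ D := by
    have e (ω : Ω) : ENNReal.ofReal (A * (1 + preActVec φ x0 w b l ω i γ ^ (2 * r))) =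
        ENNReal.ofReal A * (1 + ENNReal.ofReal (preActVec φ x0 w b l ω i γ ^ (2 * r))) := by
      rw [ENNReal.ofReal_mul hA0, ENNReal.ofReal_add zero_le_one (hnn _), ENNReal.ofReal_one]
    simp only [e]
    rw [lintegral_const_mul' _ _ ENNReal.ofReal_ne_top, lintegral_add_left measurable_const,
      hinit.lintegral_preActVec_pow hv hv1 hφm, lintegral_one, measure_univ]
    exact mul_le_mul' le_rfl (add_le_add le_rfl (mul_le_mul' (hB γ) le_rfl))
  calc _ ≤ ∫⁻ ω, ∑ β : Ker k, ENNReal.ofReal (v β) * ∑ i, ENNReal.ofReal (c : ℝ)⁻¹ *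
        ENNReal.ofReal (A * (1 + preActVec φ x0 w b l ω i (α + ((β : ℤ) : ZMod n)) ^ (2 * r)))
          ∂P := by
        refine lintegral_mono fun ω => ?_
        refine (ENNReal.ofReal_le_ofReal (layerCov_pow_le hv hv1 hc hA l ω α)).trans (le_of_eq ?_)
        have hnn' (i : Fin c) (γ : ZMod n) :
            0 ≤ A * (1 + preActVec φ x0 w b l ω i γ ^ (2 * r)) :=
          mul_nonneg hA0 (add_nonneg zero_le_one (hnn _))
        rw [ENNReal.ofReal_sum_of_nonneg fun β _ => mul_nonneg (hv β)
          (Finset.sum_nonneg fun i _ => mul_nonneg (inv_nonneg.2 hc'.le) (hnn' _ _))]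
        refine Finset.sum_congr rfl fun β _ => ?_
        rw [ENNReal.ofReal_mul (hv β), ENNReal.ofReal_sum_of_nonneg fun i _ =>
          mul_nonneg (inv_nonneg.2 hc'.le) (hnn' _ _)]
        congr 1
        exact Finset.sum_congr rfl fun i _ => ENNReal.ofReal_mul (inv_nonneg.2 hc'.le)
    _ = ∑ β : Ker k, ENNReal.ofReal (v β) * ∑ i, ENNReal.ofReal (c : ℝ)⁻¹ *
        ∫⁻ ω, ENNReal.ofReal
          (A * (1 + preActVec φ x0 w b l ω i (α + ((β : ℤ) : ZMod n)) ^ (2 * r))) ∂P := by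
        rw [lintegral_finsetSum' _ (by fun_prop)]
        refine Finset.sum_congr rfl fun β _ => ?_
        rw [lintegral_const_mul' _ _ ENNReal.ofReal_ne_top, lintegral_finsetSum' _ (by fun_prop)]
        congr 1
        exact Finset.sum_congr rfl fun i _ => lintegral_const_mul' _ _ ENNReal.ofReal_ne_top
    _ ≤ ∑ β : Ker k, ENNReal.ofReal (v β) * ∑ _i : Fin c, ENNReal.ofReal (c : ℝ)⁻¹ * D := by
        gcongr
        exact hterm _ _
    _ = D := by
        rw [← Finset.sum_mul, ← Finset.sum_mul, ← ENNReal.ofReal_sum_of_nonneg fun β _ => hv β,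
          hv1, ← ENNReal.ofReal_sum_of_nonneg fun i _ => inv_nonneg.2 hc'.le]
        simp [hc'.ne']

/-- A finite second moment of the conditional standard deviation makes the pre-activations square
integrable. -/
lemma IsGaussianInit.memLp_preActVec (hinit : IsGaussianInit P v σw σb w b)
    (hv : ∀ β, 0 ≤ v β) (hv1 : ∑ β, v β = 1) (hφm : Measurable φ) {l : ℕ} {α : ZMod n}
    (hB : ∫⁻ ω, ENNReal.ofReal
      (layerCov v σw σb (postActRV φ x0 w b l ω) α α ^ 1) ∂P ≠ ∞) (j : Fin c) :
    MemLp (fun ω => preActVec φ x0 w b l ω j α) 2 P := by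
  have hH : AEMeasurable (fun ω => preActVec φ x0 w b l ω j α) P :=
    (show Measurable fun z : Fin c → EuclideanSpace ℝ (ZMod n) => z j α by
      fun_prop).comp_aemeasurable (hinit.aemeasurable_preActVec hφm x0 l)
  rw [memLp_two_iff_integrable_sq hH.aestronglyMeasurable]
  refine ⟨(hH.pow_const 2).aestronglyMeasurable, ?_⟩
  rw [hasFiniteIntegral_iff_ofReal (.of_forall fun ω => sq_nonneg _)]
  have := hinit.lintegral_preActVec_pow (x0 := x0) hv hv1 hφm l 1 j α
  rw [mul_one] at this
  rw [this]
  exact (ENNReal.mul_ne_top hB (lintegral_pow_gaussianReal_ne_top 1)).lt_top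

lemma IsGaussianInit.integral_preActVec_eq_zero (hinit : IsGaussianInit P v σw σb w b)
    (hv : ∀ β, 0 ≤ v β) (hv1 : ∑ β, v β = 1) (hφm : Measurable φ) {l : ℕ} {α : ZMod n}
    {j : Fin c} (hL : MemLp (fun ω => preActVec φ x0 w b l ω j α) 2 P) :
    ∫ ω, preActVec φ x0 w b l ω j α ∂P = 0 := by
  rw [hinit.integral_preActVec hv hv1 hφm x0 l (f := fun z => z j α) (by fun_prop)
    (hL.integrable (by norm_num))]
  refine integral_eq_zero_of_ae (.of_forall fun ω => ?_)
  set K := layerCov v σw σb (postActRV φ x0 w b l ω)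
  have hK : K.PosSemidef := posSemidef_layerCov hv _ _ _
  have e1 := (measurePreserving_eval (fun _ : Fin c => multivariateGaussian 0 K) j)
  have e2 := (measurePreserving_eval_multivariateGaussian (μ := 0) hK (i := α))
  have e := (e2.comp e1).map_eq
  have : ∫ z, z j α ∂(Measure.pi fun _ : Fin c => multivariateGaussian 0 K) =
      ∫ x, x ∂(gaussianReal ((0 : EuclideanSpace ℝ (ZMod n)) α) (K α α).toNNReal) := by
    rw [← e, integral_map (e2.comp e1).measurable.aemeasurable (by fun_prop)]
    rfl
  simp only [Pi.zero_apply]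
  rw [this, integral_id_gaussianReal, PiLp.zero_apply]

/-- The covariance of a channel is the mean of its conditional covariance. -/
lemma IsGaussianInit.integral_preActVec_mul (hinit : IsGaussianInit P v σw σb w b)
    (hv : ∀ β, 0 ≤ v β) (hv1 : ∑ β, v β = 1) (hφm : Measurable φ) {l : ℕ} {α α' : ZMod n}
    {j : Fin c} (hL : MemLp (fun ω => preActVec φ x0 w b l ω j α) 2 P)
    (hL' : MemLp (fun ω => preActVec φ x0 w b l ω j α') 2 P) :
    ∫ ω, preActVec φ x0 w b l ω j α * preActVec φ x0 w b l ω j α' ∂P =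
      ∫ ω, layerCov v σw σb (postActRV φ x0 w b l ω) α α' ∂P := by
  rw [hinit.integral_preActVec hv hv1 hφm x0 l (f := fun z => z j α * z j α') (by fun_prop)
    (hL.integrable_mul hL')]
  refine integral_congr_ae (.of_forall fun ω => ?_)
  set K := layerCov v σw σb (postActRV φ x0 w b l ω) with hKdef
  have hK : K.PosSemidef := posSemidef_layerCov hv _ _ _
  have e1 := (measurePreserving_eval (fun _ : Fin c => multivariateGaussian 0 K) j)
  have hzero (a : ZMod n) :
      ∫ z : EuclideanSpace ℝ (ZMod n), z a ∂(multivariateGaussian 0 K) = 0 := by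
    have e2 := (measurePreserving_eval_multivariateGaussian (μ := 0) hK (i := a))
    have : ∫ z : EuclideanSpace ℝ (ZMod n), z a ∂(multivariateGaussian 0 K) =
        ∫ x, x ∂(gaussianReal ((0 : EuclideanSpace ℝ (ZMod n)) a) (K a a).toNNReal) := by
      rw [← e2.map_eq, integral_map e2.measurable.aemeasurable (by fun_prop)]
    rw [this, integral_id_gaussianReal, PiLp.zero_apply]
  have hcov := covariance_eval_multivariateGaussian (μ := 0) hK α α'
  rw [covariance] at hcov
  simp only [hzero, sub_zero] at hcov
  have h3 : ∫ z, z j α * z j α' ∂(Measure.pi fun _ : Fin c => multivariateGaussian 0 K) =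
      ∫ x, x α * x α' ∂(multivariateGaussian 0 K) := by
    conv_rhs => rw [← e1.map_eq]
    rw [integral_map e1.measurable.aemeasurable (by fun_prop)]
  exact h3.trans hcov

end Moments

/-! ### Convergence of the covariances at finite width -/

section CovarianceLimit

/-- Convergence in probability together with bounded second moments implies convergence of
expectations. -/
lemma tendsto_integral_of_tendstoInProb {Ω : ℕ → Type*} [∀ c, MeasurableSpace (Ω c)]
    {μ : ∀ c, Measure (Ω c)} [∀ c, IsProbabilityMeasure (μ c)] {Y : ∀ c, Ω c → ℝ} {s : ℝ}
    (hYm : ∀ c, AEMeasurable (Y c) (μ c)) (hY : TendstoInProb μ Y (𝓝 s)) {B : ℝ≥0∞} (hB : B ≠ ∞)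
    (hYB : ∀ᶠ c in atTop, ∫⁻ ω, ENNReal.ofReal (Y c ω ^ 2) ∂(μ c) ≤ B) :
    Tendsto (fun c => ∫ ω, Y c ω ∂(μ c)) atTop (𝓝 s) := by
  rw [Metric.tendsto_nhds]
  intro ε hε
  set R := B.toReal
  have hR : 0 ≤ R := ENNReal.toReal_nonneg
  set T := 2 * R + 2 * s ^ 2 + 1
  have hT : 0 < T := by positivity
  set η := ε / (4 * T)
  have hη : 0 < η := by positivity
  have hP := (ENNReal.tendsto_toReal ENNReal.zero_ne_top).comp
    (hY (Metric.ball s (ε / 4)) (Metric.ball_mem_nhds s (by positivity)))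
  have hP' := hP.const_mul (1 / (4 * η))
  simp only [ENNReal.toReal_zero, mul_zero] at hP'
  filter_upwards [hYB, hP'.eventually (gt_mem_nhds (show 0 < ε / 4 by positivity))] with c hc hN
  have hsq : Integrable (fun ω => Y c ω ^ 2) (μ c) := by
    refine ⟨((hYm c).pow_const 2).aestronglyMeasurable, ?_⟩
    rw [hasFiniteIntegral_iff_ofReal (.of_forall fun ω => sq_nonneg _)]
    exact hc.trans_lt hB.lt_top
  have hint : Integrable (Y c) (μ c) :=
    ((memLp_two_iff_integrable_sq (hYm c).aestronglyMeasurable).2 hsq).integrable (by norm_num)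
  have hsqR : ∫ ω, Y c ω ^ 2 ∂(μ c) ≤ R := by
    rw [integral_eq_lintegral_of_nonneg_ae (.of_forall fun ω => sq_nonneg _) hsq.1]
    exact ENNReal.toReal_mono hB hc
  set N := {ω | Y c ω ∉ Metric.ball s (ε / 4)}
  have hmN := measurableSet_toMeasurable (μ c) N
  -- off the ball, `|y| ≤ η y² + 1 / (4 η)` trades the deviation for a second moment
  have hbound (ω : Ω c) : ‖Y c ω - s‖ ≤ (ε / 4 + 2 * η * s ^ 2 + 2 * η * Y c ω ^ 2) +
      (toMeasurable (μ c) N).indicator (fun _ => 1 / (4 * η)) ω := by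
    rw [Real.norm_eq_abs]
    have hsqs : 0 ≤ 2 * η * s ^ 2 := by positivity
    have hsqY : 0 ≤ 2 * η * Y c ω ^ 2 := by positivity
    by_cases hω : ω ∈ N
    · rw [Set.indicator_of_mem (subset_toMeasurable _ _ hω)]
      have h1 : |Y c ω - s| ≤ η * (Y c ω - s) ^ 2 + 1 / (4 * η) := by
        have h2 : 0 ≤ η * (|Y c ω - s| - 1 / (2 * η)) ^ 2 := by positivity
        have h3 : η * (|Y c ω - s| - 1 / (2 * η)) ^ 2 =
            η * (Y c ω - s) ^ 2 - |Y c ω - s| + 1 / (4 * η) := by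
          rw [sub_sq, sq_abs]
          field_simp
          ring
        linarith
      have h4 : η * (Y c ω - s) ^ 2 ≤ 2 * η * s ^ 2 + 2 * η * Y c ω ^ 2 := by
        nlinarith [mul_nonneg hη.le (sq_nonneg (Y c ω + s))]
      linarith
    · have h1 : |Y c ω - s| < ε / 4 := by
        by_contra hcon
        exact hω fun h => hcon (by simpa [Real.dist_eq] using h)
      have h2 : 0 ≤ (toMeasurable (μ c) N).indicator (fun _ => 1 / (4 * η)) ω :=
        Set.indicator_nonneg (fun _ _ => by positivity) _
      linarith
  have hi1 : Integrable (fun ω => ε / 4 + 2 * η * s ^ 2 + 2 * η * Y c ω ^ 2) (μ c) :=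
    (integrable_const _).add (hsq.const_mul _)
  have hi2 : Integrable ((toMeasurable (μ c) N).indicator fun _ => 1 / (4 * η)) (μ c) :=
    (integrable_const _).indicator hmN
  have hmain := norm_integral_le_of_norm_le (hi1.add hi2) (.of_forall hbound)
  rw [integral_add' hi1 hi2, integral_indicator_const _ hmN,
    integral_add (integrable_const _) (hsq.const_mul _), integral_const_mul,
    integral_sub hint (integrable_const _)] at hmain
  simp only [integral_const, measureReal_def, measure_univ, ENNReal.toReal_one, one_mul,
    smul_eq_mul, measure_toMeasurable, Real.norm_eq_abs] at hmain
  rw [Real.dist_eq]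
  simp only [Function.comp_apply] at hN
  rw [mul_comm] at hN
  have hηT : η * T = ε / 4 := by
    simp only [η]
    field_simp
  have h5 : 2 * η * ∫ ω, Y c ω ^ 2 ∂(μ c) ≤ 2 * η * R := by gcongr
  have h6 : 2 * η * s ^ 2 + 2 * η * R ≤ ε / 4 := by
    rw [← hηT]
    simp only [T]
    nlinarith
  linarith

lemma tendsto_channelGram {n : ℕ} {x0 : ∀ c : ℕ, Fin c → ZMod n → ℝ}
    {G : Matrix (ZMod n) (ZMod n) ℝ}
    (hx0 : ∀ α α', Tendsto (fun c : ℕ => (c : ℝ)⁻¹ * ∑ i, x0 c i α * x0 c i α') atTop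
      (𝓝 (G α α'))) :
    Tendsto (fun c => channelGram (x0 c)) atTop (𝓝 G) :=
  tendsto_pi_nhds.2 fun α => tendsto_pi_nhds.2 fun α' => hx0 α α'

lemma tendsto_layerCov_input {n k : ℕ} {x0 : ∀ c : ℕ, Fin c → ZMod n → ℝ}
    {G : Matrix (ZMod n) (ZMod n) ℝ} (v : Ker k → ℝ) (σw σb : ℝ)
    (hx0 : ∀ α α', Tendsto (fun c : ℕ => (c : ℝ)⁻¹ * ∑ i, x0 c i α * x0 c i α') atTop
      (𝓝 (G α α'))) :
    Tendsto (fun c => layerCov v σw σb (x0 c)) atTop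
      (𝓝 (crossCorr v (affineCov σw σb G))) :=
  (((continuous_crossCorr v).comp (continuous_affineCov σw σb)).tendsto G).comp
    (tendsto_channelGram hx0)

variable {n k : ℕ} [NeZero n] {φ : ℝ → ℝ} {σw σb : ℝ} {v : Ker k → ℝ}
  {x0 : ∀ c : ℕ, Fin c → ZMod n → ℝ} {G : Matrix (ZMod n) (ZMod n) ℝ}
  {Ω : ℕ → Type*} [∀ c, MeasurableSpace (Ω c)]
  {μ : ∀ c, Measure (Ω c)} [∀ c, IsProbabilityMeasure (μ c)]
  {w : ∀ c : ℕ, ℕ → Fin c → Fin c → Ker k → Ω c → ℝ} {b : ∀ c : ℕ, ℕ → Fin c → Ω c → ℝ}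

/-- `limitCov φ σw σb v G l` is the infinite-channel covariance matrix of the pre-activations of
layer `l + 1`, for inputs with limiting second moments `G`. -/
noncomputable def limitCov (φ : ℝ → ℝ) (σw σb : ℝ) (v : Ker k → ℝ)
    (G : Matrix (ZMod n) (ZMod n) ℝ) : ℕ → Matrix (ZMod n) (ZMod n) ℝ
  | 0 => crossCorr v (affineCov σw σb G)
  | l + 1 => crossCorr v (cMap φ σw σb (limitCov φ σw σb v G l))

lemma posSemidef_limitCov (hv : ∀ β, 0 ≤ v β) (hφm : Measurable φ)
    (hφ : ∀ s : ℝ≥0, MemLp φ 2 (gaussianReal 0 s)) (hG : G.PosSemidef) (l : ℕ) :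
    (limitCov φ σw σb v G l).PosSemidef := by
  induction l with
  | zero => exact posSemidef_crossCorr hv (posSemidef_affineCov _ _ hG)
  | succ l ih =>
    exact posSemidef_crossCorr hv (posSemidef_affineCov _ _ (posSemidef_gaussMoment hφm hφ ih))

/-- In every layer the conditional covariance converges in probability to the deterministic limit,
along admissible matrices. -/
lemma tendstoInProb_layerCov (hinit : ∀ c, IsGaussianInit (μ c) v σw σb (w c) (b c))
    (hv : ∀ β, 0 ≤ v β) (hv1 : ∑ β, v β = 1) (hφm : Measurable φ)
    (hφ : ∀ s : ℝ≥0, MemLp φ 2 (gaussianReal 0 s))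
    (hx0 : ∀ α α', Tendsto (fun c : ℕ => (c : ℝ)⁻¹ * ∑ i, x0 c i α * x0 c i α') atTop
      (𝓝 (G α α')))
    (hφ0 : ContinuousAt φ 0 ∨ ∀ α, 0 < crossCorr v (affineCov σw σb G) α α) (l : ℕ) :
    TendstoInProb μ (fun c ω => layerCov v σw σb (postActRV φ (x0 c) (w c) (b c) l ω))
      (𝓝[admissibleCov φ (limitCov φ σw σb v G l)] (limitCov φ σw σb v G l)) := by
  have hG : G.PosSemidef :=
    posSemidef_of_tendsto (fun c => posSemidef_channelGram (x0 c)) (tendsto_channelGram hx0)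
  induction l with
  | zero =>
    refine tendstoInProb_const (x := fun c => layerCov v σw σb (x0 c))
      (tendsto_nhdsWithin_iff.2 ⟨tendsto_layerCov_input v σw σb hx0, .of_forall fun c =>
        ⟨posSemidef_layerCov hv _ _ _, fun α => ?_⟩⟩)
    exact hφ0.imp id fun h => Or.inl (h α)
  | succ l ih =>
    exact tendstoInProb_layerCov_succ hinit hv hv1 hφm hφ
      (posSemidef_limitCov hv hφm hφ hG l) ih

/-- For polynomially bounded `φ`, all moments of the conditional variances are bounded uniformly in
the width. -/
lemma exists_lintegral_layerCov_pow_le (hinit : ∀ c, IsGaussianInit (μ c) v σw σb (w c) (b c))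
    (hv : ∀ β, 0 ≤ v β) (hv1 : ∑ β, v β = 1) (hφm : Measurable φ)
    (hx0 : ∀ α α', Tendsto (fun c : ℕ => (c : ℝ)⁻¹ * ∑ i, x0 c i α * x0 c i α') atTop
      (𝓝 (G α α')))
    {C : ℝ} {p : ℕ} (hC : ∀ x, |φ x| ≤ C * (1 + |x|) ^ p) (l q : ℕ) :
    ∃ B : ℝ≥0∞, B ≠ ∞ ∧ ∀ c, 0 < c → ∀ α, ∫⁻ ω, ENNReal.ofReal
      (layerCov v σw σb (postActRV φ (x0 c) (w c) (b c) l ω) α α ^ q) ∂(μ c) ≤ B := by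
  induction l generalizing q with
  | zero =>
    have hbdd (α : ZMod n) : ∃ D, ∀ c, layerCov v σw σb (x0 c) α α ^ q ≤ D := by
      have h1 : Continuous fun K : Matrix (ZMod n) (ZMod n) ℝ => K α α ^ q := by fun_prop
      obtain ⟨D, hD⟩ := ((h1.tendsto _).comp
        (tendsto_layerCov_input v σw σb hx0)).bddAbove_range
      exact ⟨D, fun c => hD ⟨c, rfl⟩⟩
    choose D hD using hbdd
    refine ⟨∑ α, ENNReal.ofReal (D α),
      ENNReal.sum_ne_top.2 fun _ _ => ENNReal.ofReal_ne_top, fun c _ α => ?_⟩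
    have h0 (ω : Ω c) : postActRV φ (x0 c) (w c) (b c) 0 ω = x0 c := rfl
    simp only [h0, lintegral_const, measure_univ, mul_one]
    exact (ENNReal.ofReal_le_ofReal (hD α c)).trans
      (Finset.single_le_sum (f := fun α => ENNReal.ofReal (D α)) (fun _ _ => zero_le)
        (Finset.mem_univ α))
  | succ l ih =>
    obtain ⟨A, hA0, hA⟩ := exists_pow_affine_le hC σw σb q
    obtain ⟨B, hB, hBc⟩ := ih (p * q)
    refine ⟨_, ?_, fun c hc α => (hinit c).lintegral_layerCov_pow_succ_le hv hv1 hφm hc hA0 hA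
      (hBc c hc) α⟩
    exact ENNReal.mul_ne_top ENNReal.ofReal_ne_top (ENNReal.add_ne_top.2 ⟨ENNReal.one_ne_top,
      ENNReal.mul_ne_top hB (lintegral_pow_gaussianReal_ne_top _)⟩)

/-- For polynomially bounded `φ`, the mean conditional covariance converges to the limit
covariance. -/
lemma tendsto_integral_layerCov (hinit : ∀ c, IsGaussianInit (μ c) v σw σb (w c) (b c))
    (hv : ∀ β, 0 ≤ v β) (hv1 : ∑ β, v β = 1) (hφm : Measurable φ)
    (hφ : ∀ s : ℝ≥0, MemLp φ 2 (gaussianReal 0 s))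
    (hx0 : ∀ α α', Tendsto (fun c : ℕ => (c : ℝ)⁻¹ * ∑ i, x0 c i α * x0 c i α') atTop
      (𝓝 (G α α')))
    (hφ0 : ContinuousAt φ 0 ∨ ∀ α, 0 < crossCorr v (affineCov σw σb G) α α)
    {C : ℝ} {p : ℕ} (hC : ∀ x, |φ x| ≤ C * (1 + |x|) ^ p) (l : ℕ) (α α' : ZMod n) :
    Tendsto (fun c => ∫ ω, layerCov v σw σb (postActRV φ (x0 c) (w c) (b c) l ω) α α' ∂(μ c))
      atTop (𝓝 (limitCov φ σw σb v G l α α')) := by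
  have hKm (c : ℕ) (a a' : ZMod n) : AEMeasurable (fun ω =>
      layerCov v σw σb (postActRV φ (x0 c) (w c) (b c) l ω) a a') (μ c) :=
    (measurable_layerCov_apply v σw σb a a').comp_aemeasurable
      ((hinit c).aemeasurable_postActRV hφm (x0 c) l)
  have hcont : Continuous fun K : Matrix (ZMod n) (ZMod n) ℝ => K α α' := by fun_prop
  have hprob : TendstoInProb μ (fun c ω =>
      layerCov v σw σb (postActRV φ (x0 c) (w c) (b c) l ω) α α')
      (𝓝 (limitCov φ σw σb v G l α α')) := by
    have h1 := tendstoInProb_layerCov hinit hv hv1 hφm hφ hx0 hφ0 l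
    have h2 : Tendsto (fun K : Matrix (ZMod n) (ZMod n) ℝ => K α α')
        (𝓝[admissibleCov φ (limitCov φ σw σb v G l)] (limitCov φ σw σb v G l))
        (𝓝 (limitCov φ σw σb v G l α α')) :=
      (hcont.tendsto (limitCov φ σw σb v G l)).mono_left nhdsWithin_le_nhds
    have h3 := h1.comp h2
    exact h3
  obtain ⟨B, hB, hBc⟩ := exists_lintegral_layerCov_pow_le hinit hv hv1 hφm hx0 hC l 2
  refine tendsto_integral_of_tendstoInProb (B := B + B) (fun c => hKm c α α')
    hprob (ENNReal.add_ne_top.2 ⟨hB, hB⟩) ?_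
  filter_upwards [eventually_gt_atTop 0] with c hc
  refine le_trans ?_ (add_le_add (hBc c hc α) (hBc c hc α'))
  rw [← lintegral_add_left' ((hKm c α α).pow_const 2).ennreal_ofReal]
  refine lintegral_mono fun ω => ?_
  rw [← ENNReal.ofReal_add (sq_nonneg _) (sq_nonneg _)]
  refine ENNReal.ofReal_le_ofReal ?_
  have h := abs_apply_le_of_posSemidef
    (posSemidef_layerCov hv σw σb (postActRV φ (x0 c) (w c) (b c) l ω)) α α'
  set K := layerCov v σw σb (postActRV φ (x0 c) (w c) (b c) l ω)
  have h2 := pow_le_pow_left₀ (abs_nonneg _) h 2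
  rw [sq_abs] at h2
  nlinarith [sq_nonneg (K α α - K α' α')]

end CovarianceLimit

theorem mainTheorem4 {n k : ℕ} [NeZero n] (φ : ℝ → ℝ) (σw σb : ℝ)
    (v : Ker k → ℝ) (hv : ∀ β, 0 ≤ v β) (hv1 : ∑ β, v β = 1)
    (hφm : Measurable φ)
    -- the `𝒞`-map is well defined: `φ` is square integrable under every centered Gaussian
    (hφ : ∀ s : ℝ≥0, MemLp φ 2 (gaussianReal 0 s))
    -- for every width `c`, an input `x^0` with `c` channels, with convergent Gram matrix
    (x0 : ∀ c : ℕ, Fin c → ZMod n → ℝ) (G : Matrix (ZMod n) (ZMod n) ℝ)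
    (hx0 : ∀ α α', Tendsto (fun c : ℕ => (c : ℝ)⁻¹ * ∑ i, x0 c i α * x0 c i α') atTop
      (𝓝 (G α α')))
    (hφ0 : ContinuousAt φ 0 ∨ ∀ α, 0 < crossCorr v (affineCov σw σb G) α α)
    -- for every width `c`, a random initialization on some probability space
    {Ω : ℕ → Type*} [∀ c, MeasurableSpace (Ω c)] (μ : ∀ c, Measure (Ω c))
    [∀ c, IsProbabilityMeasure (μ c)]
    (w : ∀ c : ℕ, ℕ → Fin c → Fin c → Ker k → Ω c → ℝ) (b : ∀ c : ℕ, ℕ → Fin c → Ω c → ℝ)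
    (hinit : ∀ c, IsGaussianInit (μ c) v σw σb (w c) (b c))
    -- `h c l ω j α` is the pre-activation of layer `l + 1` at width `c`
    (h : ∀ c : ℕ, ℕ → Ω c → Fin c → ZMod n → ℝ)
    (hh : ∀ c l ω, h c l ω = nextPreAct φ (x0 c) (fun l i j β => w c l i j β ω)
      (fun l j => b c l j ω) l) :
    -- `S l` is the infinite-channel covariance matrix of layer `l` (used for `l ≥ 1`)
    ∃ S : ℕ → Matrix (ZMod n) (ZMod n) ℝ,
      (∀ l, (S (l + 1)).PosSemidef) ∧
      -- the channels of layer `l + 1` become i.i.d. centered Gaussian with covariance `S (l + 1)`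
      (∀ l m : ℕ, TendstoInDistribution
        (fun (d : ℕ) (ω : Ω (m + d)) (j : Fin m) =>
          (WithLp.toLp 2 (h (m + d) l ω (Fin.castAdd d j)) : EuclideanSpace ℝ (ZMod n)))
        atTop id (fun d => μ (m + d))
        (Measure.pi fun _ : Fin m => multivariateGaussian 0 (S (l + 1)))) ∧
      -- for polynomially bounded `φ` the covariances at finite width converge to `S (l + 1)`
      ((∃ (C : ℝ) (p : ℕ), ∀ x, |φ x| ≤ C * (1 + |x|) ^ p) →
        (∀ c l j α, MemLp (fun ω => h c l ω j α) 2 (μ c) ∧ ∫ ω, h c l ω j α ∂(μ c) = 0) ∧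
        ∀ l, ∀ ε > 0, ∀ᶠ c : ℕ in atTop, ∀ (j : Fin c) (α α' : ZMod n),
          |∫ ω, h c l ω j α * h c l ω j α' ∂(μ c) - S (l + 1) α α'| < ε) ∧
      -- first layer
      S 1 = crossCorr v (affineCov σw σb G) ∧
      (∀ S0 : Matrix (ZMod n) (ZMod n) ℝ, S0.PosSemidef → G = gaussMoment φ S0 →
        S 1 = crossCorr v (cMap φ σw σb S0)) ∧
      -- the recurrence relation
      ∀ l, 1 ≤ l → S (l + 1) = crossCorr v (cMap φ σw σb (S l)) := by
  obtain rfl : h = fun c l ω => nextPreAct φ (x0 c) (fun l i j β => w c l i j β ω)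
      (fun l j => b c l j ω) l := by
    funext c l ω
    exact hh c l ω
  have hG : G.PosSemidef :=
    posSemidef_of_tendsto (fun c => posSemidef_channelGram (x0 c)) (tendsto_channelGram hx0)
  have hpsd := posSemidef_limitCov (σw := σw) (σb := σb) hv hφm hφ hG
  -- the value at `0` is irrelevant
  refine ⟨fun l => limitCov φ σw σb v G (l - 1), fun l => hpsd l, fun l m => ?_, ?_, rfl, ?_, ?_⟩
  · have hK := tendstoInProb_layerCov hinit hv hv1 hφm hφ hx0 hφ0 l
    refine tendstoInDistribution_preActVec hinit hv hv1 hφm (hpsd l) (fun V hV => hK V ?_) m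
    exact nhdsWithin_mono _ (fun K hK => hK.1) hV
  · rintro ⟨C, p, hC⟩
    have hL (c l : ℕ) (j : Fin c) (α : ZMod n) :
        MemLp (fun ω => preActVec φ (x0 c) (w c) (b c) l ω j α) 2 (μ c) := by
      obtain ⟨B, hB, hBc⟩ := exists_lintegral_layerCov_pow_le hinit hv hv1 hφm hx0 hC l 1
      exact (hinit c).memLp_preActVec hv hv1 hφm
        (ne_top_of_le_ne_top hB (hBc c j.pos α)) j
    refine ⟨fun c l j α => ⟨hL c l j α,
      (hinit c).integral_preActVec_eq_zero hv hv1 hφm (hL c l j α)⟩, fun l ε hε => ?_⟩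
    have hlim (α α' : ZMod n) := (Metric.tendsto_nhds.1
      (tendsto_integral_layerCov hinit hv hv1 hφm hφ hx0 hφ0 hC l α α')) ε hε
    filter_upwards [eventually_all.2 fun α => eventually_all.2 fun α' => hlim α α']
      with c hc j α α'
    have := hc α α'
    rw [← (hinit c).integral_preActVec_mul hv hv1 hφm (hL c l j α) (hL c l j α')] at this
    exact this
  · rintro S0 - rfl
    rfl
  · intro l hl
    obtain ⟨l, rfl⟩ := Nat.exists_eq_add_of_le' hl
    rfl
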